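/- Let $\Omega\subset\mathbb{R}^2$ be a compact set, and let $\mathcal{B}(\Omega)$ be the set of Borel probability measures on $\Omega$ with the topology of weak convergence (tested against bounded continuous functions on $\Omega$). For $\mu\in\mathcal{B}(\Omega)$ put $E(\mu)=\int_\Omega\rho\ln\rho\,dx\in\mathbb{R}\cup\{+\infty\}$ if $\mu=\rho\,dx$ has a density with respect to Lebesgue measure, and $E(\mu)=+\infty$ otherwise. For a set $X=\{x_1,\dots,x_N\}$ of $N$ distinct points of $\Omega$ put $\delta_X=\frac1N\sum_{i=1}^N\delta_{x_i}$ and, for $N\ge 2$, $r_i(X)=\frac12\min_{j\ne i}|x_i-x_j|$ and $$\mathcal{E}(X)=-\frac{2}{N}\sum_{i=1}^{N}\ln r_i(X)-\ln\bigl(2\sqrt3\,N\bigr)$$ (for $N=1$ the value $\mathcal{E}(X)\in\mathbb{R}$ is an arbitrary convention and plays no role). Then $\mathcal{E}$ is a $\Gamma$-approximation of the entropy $E$, that is: (i) for every sequence $(X_N)_{N\ge1}$, where $X_N$ consists of $N$ distinct points of $\Omega$, and every $\mu\in\mathcal{B}(\Omega)$ such that $\delta_{X_N}\to\mu$ weakly,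 $\liminf_{N\to\infty}\mathcal{E}(X_N)\ge E(\mu)$; (ii) for every $\mu\in\mathcal{B}(\Omega)$ with $E(\mu)<\infty$ there is a sequence $(\tilde X_N)_{N\ge1}$, where $\tilde X_N$ consists of $N$ distinct points of $\Omega$, such that $\delta_{\tilde X_N}\to\mu$ weakly and $\lim_{N\to\infty}\mathcal{E}(\tilde X_N)=E(\mu)$. -/

import Mathlib

open MeasureTheory Filter Topology
open scoped ENNReal

noncomputable section

namespace EntropyApprox

/-- The Euclidean plane. -/
abbrev Plane : Type := EuclideanSpace ℝ (Fin 2)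

/-- The Lebesgue measure of the plane, restricted to `Ω`, as a measure on the subtype `Ω`. -/
def area (Ω : Set Plane) : Measure Ω := (volume : Measure Plane).comap Subtype.val

/-- The entropy `E(μ) = ∫_Ω ρ ln ρ` of a Borel probability measure `μ` on `Ω`, where `ρ` is the
density of `μ` with respect to the Lebesgue measure on `Ω`, and `E(μ) = +∞` if `μ` has no
density.
The Lebesgue integral is the integral of the positive part minus that of the negative part. The
latter is finite when `Ω` has finite area, as `t ln t ≥ -1/e`; the former may be `+∞`. -/
def entropy {Ω : Set Plane} (μ : ProbabilityMeasure Ω) : EReal :=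
  open Classical in
  let ρ : Ω → ℝ := fun x => ((μ : Measure Ω).rnDeriv (area Ω) x).toReal
  if (μ : Measure Ω) ≪ area Ω then
    ((∫⁻ x, ENNReal.ofReal (ρ x * Real.log (ρ x)) ∂(area Ω) : ℝ≥0∞) : EReal)
      - ((∫⁻ x, ENNReal.ofReal (-(ρ x * Real.log (ρ x))) ∂(area Ω) : ℝ≥0∞) : EReal)
  else ⊤

/-- The finite nonempty unordered families `X = (x₁, …, x_N)`, `N ≥ 1`, of distinct points
of `Ω`. -/
abbrev Configuration (Ω : Set Plane) : Type := {X : Finset Ω // X.Nonempty}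

/-- The number `N(X)` of points of a configuration. -/
def numPoints {Ω : Set Plane} (X : Configuration Ω) : ℕ := X.1.card

/-- The empirical measure `δ_X = N(X)⁻¹ ∑ᵢ δ_{xᵢ}`. -/
def empirical {Ω : Set Plane} (X : Configuration Ω) : ProbabilityMeasure Ω :=
  ⟨(numPoints X : ℝ≥0∞)⁻¹ • ∑ x ∈ X.1, Measure.dirac x, ⟨by
    have h : (X.1.card : ℝ≥0∞) ≠ 0 := by
      exact_mod_cast (Finset.card_pos.mpr X.2).ne'
    simp [numPoints, ENNReal.inv_mul_cancel h (ENNReal.natCast_ne_top _)]⟩⟩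

/-- `r_x(X)`: half the minimal distance from `x` to the other points of `X`.
(If `X` has no other point, the value is `0` by convention.) -/
def halfMinDist {Ω : Set Plane} (X : Configuration Ω) (x : Ω) : ℝ :=
  (1 / 2) * Metric.infDist x ((X.1 : Set Ω) \ {x})

/-- `𝓔(X) = -(2 / N(X)) ∑ᵢ ln rᵢ(X) - ln (2 √3 N(X))`. -/
def discreteEntropy {Ω : Set Plane} (X : Configuration Ω) : ℝ :=
  -(2 / (numPoints X : ℝ)) * ∑ x ∈ X.1, Real.log (halfMinDist X x)
    - Real.log (2 * Real.sqrt 3 * (numPoints X : ℝ))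

/-- `F`, a function on configurations with values in `ℝ ∪ {+∞}`, is a `Γ`-approximation of the
entropy. Convergence of measures is convergence in the topology of `ProbabilityMeasure Ω`, that
is, weak convergence tested against bounded continuous functions. -/
structure IsGammaApproximation {Ω : Set Plane} (F : Configuration Ω → EReal) : Prop where
  ne_bot : ∀ X, F X ≠ ⊥
  liminf_ge : ∀ (X : ℕ+ → Configuration Ω) (μ : ProbabilityMeasure Ω),
    (∀ N : ℕ+, numPoints (X N) = N) →
    Tendsto (fun N => empirical (X N)) atTop (𝓝 μ) →
    entropy μ ≤ liminf (fun N => F (X N)) atTop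
  exists_recovery : ∀ μ : ProbabilityMeasure Ω, entropy μ < ⊤ →
    ∃ X : ℕ+ → Configuration Ω,
      (∀ N : ℕ+, numPoints (X N) = N) ∧
      Tendsto (fun N => empirical (X N)) atTop (𝓝 μ) ∧
      Tendsto (fun N => F (X N)) atTop (𝓝 (entropy μ))

end EntropyApprox

end

namespace EntropyApprox

/-! The number `2 √3 r²` is the area of the regular hexagon of inradius `r`, so `𝓔(X)` is the
average of `-ln (N · hexagon area)`, a discrete form of `∫ ln ρ dμ`.

Lower bound. The inequality `ln t ≤ t - 1` with `t = 2 √3 N r² exp φ` gives, after averaging over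
the points, `𝓔(X) ≥ ∫ φ dδ_X + 1 - ∑ 2 √3 r_x² exp (φ x)`. The packing lemma `exists_cells` provides
disjoint cells around the points, of at least the hexagon areas, inside discs of radius `2 / √3 *
r_x`. If the radii are small and `φ` is continuous, the sum is therefore at most about `∫ exp φ`.
Passing to the limit gives `∫ φ dμ + 1 - ∫ exp φ`, whose supremum over continuous `φ` is `E(μ)`
(`exists_continuous_lt_dualEntropy_of_lt_entropy`). Radii above a threshold `η` are truncated; this
costs `O(1 / N)` because `∑ r_x²` is bounded, again by packing (`exists_sum_sq_halfMinDist_le`).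

The packing lemma intersects each disc with its power cell. What is lost lies in caps beyond radical
axes. Each cap is at most a fixed fraction of its circular sector, the extreme case being angle `π /
3`, and the sectors are disjoint because no three discs overlap. Hence the cell keeps at least the
share of the disc that its inscribed hexagon has.

Recovery. Split `Ω` into small pieces, take compact subsets of almost full area, and fill each with
a triangular lattice whose spacing gives it its share of the `N` points
(`eventually_exists_configuration`). Then `𝓔` is at most about `∑ μ(Aᵢ) ln (μ(Aᵢ) / |Aᵢ|)`, which
Jensen's inequality bounds by `E(μ)`. A diagonal choice gives a sequence with `limsup 𝓔 ≤ E(μ)`, and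
the lower bound supplies the rest. -/

theorem measurableSet_and {α : Type*} [MeasurableSpace α] {p q : α → Prop}
    (hp : MeasurableSet {x | p x}) (hq : MeasurableSet {x | q x}) :
    MeasurableSet {x | p x ∧ q x} := hp.inter hq

/-! ### Areas of circular sectors and caps -/

open Real Set in
theorem volume_sector_le {R c : ℝ} (hR : 0 ≤ R) (hc : -1 ≤ c) :
    volume {q : ℝ × ℝ | √(q.1 ^ 2 + q.2 ^ 2) < R ∧ c * √(q.1 ^ 2 + q.2 ^ 2) < q.1} ≤
      ENNReal.ofReal (R ^ 2 * arccos c) := by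
  set S := {q : ℝ × ℝ | √(q.1 ^ 2 + q.2 ^ 2) < R ∧ c * √(q.1 ^ 2 + q.2 ^ 2) < q.1} with hS
  have hm : MeasurableSet S := by
    refine measurableSet_and (measurableSet_lt ?_ ?_) (measurableSet_lt ?_ ?_) <;> fun_prop
  rw [← lintegral_indicator_one hm, ← lintegral_comp_polarCoord_symm]
  calc ∫⁻ p in polarCoord.target, ENNReal.ofReal p.1 • S.indicator 1 (polarCoord.symm p)
      ≤ ∫⁻ p in polarCoord.target,
          (Ioo 0 R ×ˢ Ioo (-arccos c) (arccos c)).indicator (fun p => ENNReal.ofReal p.1) p := by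
        refine setLIntegral_mono' polarCoord.open_target.measurableSet fun p hp => ?_
        obtain ⟨r, θ⟩ := p
        simp only [polarCoord_target, mem_prod, mem_Ioi, mem_Ioo] at hp
        obtain ⟨hr, hθ1, hθ2⟩ := hp
        by_cases hq : polarCoord.symm (r, θ) ∈ S
        · have h1 : √((r * cos θ) ^ 2 + (r * sin θ) ^ 2) = r := by
            rw [mul_pow, mul_pow, ← mul_add, cos_sq_add_sin_sq, mul_one, sqrt_sq hr.le]
          simp only [hS, polarCoord_symm_apply, mem_ofPred_eq, h1] at hq
          have h2 : c < cos θ := by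
            have := hq.2
            rw [mul_comm] at this
            exact lt_of_mul_lt_mul_left this hr.le
          have h3 : |θ| < arccos c := by
            rw [← cos_abs] at h2
            by_contra! hle
            have h4 :=
              cos_le_cos_of_nonneg_of_le_pi (arccos_nonneg c) (abs_le.2 ⟨hθ1.le, hθ2.le⟩) hle
            rw [cos_arccos hc (h2.le.trans (cos_le_one _))] at h4
            linarith
          rw [indicator_of_mem (s := Ioo 0 R ×ˢ Ioo (-arccos c) (arccos c))]
          · calc _ ≤ ENNReal.ofReal r * 1 := by
                  rw [smul_eq_mul]; gcongr; exact indicator_le_self' (by simp) _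
              _ = _ := by simp
          · exact ⟨⟨hr, hq.1⟩, abs_lt.1 h3⟩
        · rw [indicator_of_notMem hq]; simp
    _ ≤ ∫⁻ p, (Ioo 0 R ×ˢ Ioo (-arccos c) (arccos c)).indicator
          (fun p => ENNReal.ofReal p.1) p := setLIntegral_le_lintegral _ _
    _ = ∫⁻ p in Ioo 0 R ×ˢ Ioo (-arccos c) (arccos c), ENNReal.ofReal p.1 :=
        lintegral_indicator (measurableSet_Ioo.prod measurableSet_Ioo) _
    _ = ENNReal.ofReal (R ^ 2 * arccos c) := by
        rw [Measure.volume_eq_prod, setLIntegral_prod _ (by fun_prop)]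
        simp only [setLIntegral_const, Real.volume_Ioo]
        rw [lintegral_mul_const _ (by fun_prop), ← ofReal_integral_eq_lintegral_ofReal]
        · rw [← integral_Ioc_eq_integral_Ioo, ← intervalIntegral.integral_of_le hR, integral_id,
            ← ENNReal.ofReal_mul (by nlinarith [sq_nonneg R])]
          congr 1; ring
        · exact (continuous_id.integrableOn_Icc).mono_set Ioo_subset_Icc_self
        · exact (ae_restrict_mem measurableSet_Ioo).mono fun x hx => hx.1.le

open Real Set in
theorem volume_triangle {h t : ℝ} (hh : 0 ≤ h) (ht : 0 ≤ t) :
    volume {q : ℝ × ℝ | q.1 ∈ Ioo 0 h ∧ q.2 ∈ Ioo (-(t * q.1)) (t * q.1)} =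
      ENNReal.ofReal (h ^ 2 * t) := by
  have := volume_regionBetween_eq_integral (μ := (volume : Measure ℝ)) (s := Ioo 0 h)
    (f := fun x => -(t * x)) (g := fun x => t * x)
    ((Continuous.integrableOn_Icc (by fun_prop)).mono_set Ioo_subset_Icc_self)
    ((Continuous.integrableOn_Icc (by fun_prop)).mono_set Ioo_subset_Icc_self)
    measurableSet_Ioo (fun x hx => by nlinarith [hx.1, mul_nonneg ht hx.1.le])
  rw [Measure.volume_eq_prod]
  refine this.trans ?_
  congr 1
  rw [← integral_Ioc_eq_integral_Ioo, ← intervalIntegral.integral_of_le hh]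
  have : ∀ x : ℝ, ((fun x => t * x) - fun x => -(t * x)) x = (2 * t) * x := fun x => by
    simp; ring
  simp only [this]
  rw [intervalIntegral.integral_const_mul, integral_id]; ring

-- Concavity of `sin` on `[0, π]`: at `2 α ≤ π / 3` the graph lies above the chord from `0` to `π /
-- 3`.
open Real in
theorem mul_le_sin_mul_cos {α : ℝ} (h0 : 0 ≤ α) (h1 : α ≤ π / 6) :
    3 * √3 / (2 * π) * α ≤ sin α * cos α := by
  have h := strictConcaveOn_sin_Icc.concaveOn.2
    (show (0 : ℝ) ∈ Set.Icc 0 π from ⟨le_rfl, pi_pos.le⟩)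
    (show π / 3 ∈ Set.Icc 0 π from ⟨by positivity, by linarith [pi_pos]⟩)
    (show 0 ≤ 1 - 6 * α / π by rw [sub_nonneg, div_le_one pi_pos]; linarith)
    (show 0 ≤ 6 * α / π by positivity) (by ring)
  simp only [smul_eq_mul, sin_zero, sin_pi_div_three, mul_zero, zero_add] at h
  have e : 6 * α / π * (π / 3) = 2 * α := by field_simp; ring
  rw [e, sin_two_mul] at h
  have e2 : 3 * √3 / (2 * π) * α = (6 * α / π * (√3 / 2)) / 2 := by field_simp; ring
  rw [e2]; linarith

/-- The fraction of a circular sector of angle `π / 3` that lies beyond its chord. -/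
noncomputable def capRatio : ℝ := 1 - 3 * √3 / (2 * Real.pi)

theorem capRatio_nonneg : 0 ≤ capRatio := by
  have h := mul_le_sin_mul_cos (α := Real.pi / 6) (by positivity) le_rfl
  rw [Real.sin_pi_div_six, Real.cos_pi_div_six] at h
  have h3 : √3 ≤ 1.74 := by
    rw [Real.sqrt_le_left (by norm_num)]; norm_num
  have := Real.pi_gt_three
  rw [capRatio, sub_nonneg, div_le_one (by positivity)]
  linarith

-- The cap is contained in the sector minus the triangle spanned by the centre and the chord. With
-- half-angle `α ≤ π / 6` the triangle has area `R² sin α cos α`, at least the fraction `1 -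
-- capRatio` of `R² α`.
open Real Set in
theorem volume_cap_le_sector {R h : ℝ} (hR : 0 < R) (hh : √3 / 2 * R ≤ h) :
    volume {q : ℝ × ℝ | √(q.1 ^ 2 + q.2 ^ 2) < R ∧ h ≤ q.1} ≤ ENNReal.ofReal capRatio *
      volume {q : ℝ × ℝ | √(q.1 ^ 2 + q.2 ^ 2) < R ∧ h / R * √(q.1 ^ 2 + q.2 ^ 2) < q.1} := by
  have h0 : 0 < h := lt_of_lt_of_le (by positivity) hh
  set S := {q : ℝ × ℝ | √(q.1 ^ 2 + q.2 ^ 2) < R ∧ h / R * √(q.1 ^ 2 + q.2 ^ 2) < q.1} with hS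
  set C := {q : ℝ × ℝ | √(q.1 ^ 2 + q.2 ^ 2) < R ∧ h ≤ q.1} with hC
  rcases le_or_gt R h with hle | hlt
  · have : C = ∅ := by
      ext q
      simp only [hC, mem_ofPred_eq, mem_empty_iff_false, iff_false, not_and, not_le]
      intro hq
      have : q.1 ≤ √(q.1 ^ 2 + q.2 ^ 2) := le_sqrt_of_sq_le (by nlinarith [sq_nonneg q.2])
      linarith
    simp [this]
  set c := h / R with hc
  have hc0 : 0 < c := by positivity
  have hc1 : c < 1 := (div_lt_one hR).2 hlt
  have hc2 : √3 / 2 ≤ c := (le_div_iff₀ hR).2 hh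
  set α := arccos c with hα
  have hα0 : 0 < α := arccos_pos.2 hc1
  have hα1 : α ≤ π / 6 := by
    have : arccos (√3 / 2) = π / 6 := by
      rw [← cos_pi_div_six, arccos_cos (by positivity) (by linarith [pi_pos])]
    rw [hα, ← this]; exact arccos_le_arccos hc2
  have hcos : cos α = c := cos_arccos (by linarith) hc1.le
  have hsin : 0 ≤ sin α := sin_nonneg_of_nonneg_of_le_pi hα0.le (by linarith [pi_pos])
  -- The slope `sin α / c` is `tan α`, so the open triangle ends at the chord `q.1 = h`.
  set T := {q : ℝ × ℝ | q.1 ∈ Ioo 0 h ∧ q.2 ∈ Ioo (-((sin α / c) * q.1)) ((sin α / c) * q.1)}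
    with hT
  have hmT : MeasurableSet T := by
    refine (measurableSet_preimage measurable_fst measurableSet_Ioo).inter ?_
    refine measurableSet_and (measurableSet_lt ?_ ?_) (measurableSet_lt ?_ ?_) <;> fun_prop
  have hTS : T ⊆ S := by
    rintro ⟨x, y⟩ ⟨⟨hx0, hxh⟩, hy⟩
    dsimp only at hx0 hxh hy
    have hy2 : |y| < sin α / c * x := abs_lt.2 hy
    have hy3 : c * |y| < sin α * x := by
      rw [div_mul_eq_mul_div, lt_div_iff₀ hc0] at hy2; linarith
    have hy4 : c ^ 2 * y ^ 2 < sin α ^ 2 * x ^ 2 := by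
      rw [← sq_abs y, ← mul_pow, ← mul_pow]
      exact pow_lt_pow_left₀ hy3 (by positivity) two_ne_zero
    have hsc : sin α ^ 2 = 1 - c ^ 2 := by rw [sin_sq, hcos]
    have key : c * √(x ^ 2 + y ^ 2) < x := by
      rw [← sqrt_sq hc0.le, ← sqrt_mul (by positivity), sqrt_lt' hx0]
      nlinarith
    refine ⟨?_, key⟩
    have : c * √(x ^ 2 + y ^ 2) < c * R := by
      have : c * R = h := by rw [hc]; field_simp
      rw [this]; exact key.trans hxh
    exact lt_of_mul_lt_mul_left this hc0.le
  have hCS : C ⊆ S \ T := by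
    rintro ⟨x, y⟩ ⟨h1, h2⟩
    dsimp only at h1 h2
    refine ⟨⟨h1, ?_⟩, fun h3 => by linarith [h3.1.2]⟩
    have : h / R * √(x ^ 2 + y ^ 2) < h / R * R := by gcongr
    rw [div_mul_cancel₀ _ hR.ne'] at this
    dsimp only; linarith
  have hSle : volume S ≤ ENNReal.ofReal (R ^ 2 * α) := volume_sector_le hR.le (by linarith)
  have hSfin : volume S ≠ ∞ := (hSle.trans_lt ENNReal.ofReal_lt_top).ne
  have hTv : volume T = ENNReal.ofReal (h ^ 2 * (sin α / c)) :=
    volume_triangle h0.le (by positivity)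
  have hTfin : volume T ≠ ∞ := by simp [hTv]
  have hSr : volume.real S ≤ R ^ 2 * α := by
    rw [Measure.real]; exact ENNReal.toReal_le_of_le_ofReal (by positivity) hSle
  have hTr : volume.real T = h ^ 2 * (sin α / c) := by
    rw [Measure.real, hTv, ENNReal.toReal_ofReal (by positivity)]
  have h5 : 3 * √3 / (2 * π) * volume.real S ≤ volume.real T := by
    rw [hTr]
    have e : h ^ 2 * (sin α / c) = R ^ 2 * (sin α * cos α) := by
      have : h = c * R := by rw [hc]; field_simp
      rw [this, hcos]; field_simp
    rw [e]
    calc _ ≤ 3 * √3 / (2 * π) * (R ^ 2 * α) := by gcongr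
      _ = R ^ 2 * (3 * √3 / (2 * π) * α) := by ring
      _ ≤ _ := mul_le_mul_of_nonneg_left (mul_le_sin_mul_cos hα0.le hα1) (by positivity)
  calc volume C ≤ volume (S \ T) := measure_mono hCS
    _ = ENNReal.ofReal (volume.real (S \ T)) := by
      rw [ofReal_measureReal (measure_ne_top_of_subset sdiff_subset hSfin)]
    _ ≤ ENNReal.ofReal (capRatio * volume.real S) := by
      rw [measureReal_sdiff hTS hmT hSfin, capRatio]
      apply ENNReal.ofReal_le_ofReal
      linarith
    _ = _ := by rw [ENNReal.ofReal_mul capRatio_nonneg, ofReal_measureReal hSfin]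

/-- Orthonormal coordinates of the plane with prescribed first basis vector. -/
theorem exists_measurePreserving_coordinates (u : Plane) (hu : ‖u‖ = 1) :
    ∃ f : Plane → ℝ × ℝ, MeasurePreserving f volume volume ∧
      (∀ p, (f p).1 = inner ℝ u p) ∧ ∀ p, √((f p).1 ^ 2 + (f p).2 ^ 2) = ‖p‖ := by
  have ho : Orthonormal ℝ (({0} : Set (Fin 2)).domRestrict fun _ => u) := by
    refine ⟨fun _ => hu, fun i j hij => ?_⟩
    exact absurd (Subsingleton.elim i j) hij
  obtain ⟨b, hb⟩ := ho.exists_orthonormalBasis_extension_of_card_eq (by simp)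
  refine ⟨fun p => (b.repr p 0, b.repr p 1), ?_, fun p => ?_, fun p => ?_⟩
  · have h1 := b.measurePreserving_repr
    have h2 := EuclideanSpace.volume_preserving_symm_measurableEquiv_toLp (Fin 2)
    have h3 := volume_preserving_finTwoArrow ℝ
    exact h3.comp (h2.comp h1)
  · dsimp only
    rw [b.repr_apply_apply, hb 0 rfl]
  · rw [← b.repr.norm_map p, EuclideanSpace.norm_eq]
    simp [Fin.sum_univ_two]

theorem volume_cap_le_sector_plane {R h : ℝ} (hR : 0 < R) (hh : √3 / 2 * R ≤ h) (x u : Plane)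
    (hu : ‖u‖ = 1) :
    volume {p : Plane | ‖p - x‖ < R ∧ h ≤ inner ℝ u (p - x)} ≤ ENNReal.ofReal capRatio *
      volume {p : Plane | ‖p - x‖ < R ∧ h / R * ‖p - x‖ < inner ℝ u (p - x)} := by
  obtain ⟨f, hf, hf1, hf2⟩ := exists_measurePreserving_coordinates u hu
  have hg : MeasurePreserving (fun p => f (p - x)) volume volume :=
    hf.comp (measurePreserving_sub_right volume x)
  have := volume_cap_le_sector hR hh
  rw [← hg.measure_preimage, ← hg.measure_preimage] at this
  · simp only [Set.preimage_ofPred_eq, hf2] at this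
    simpa only [hf1] using this
  · refine (measurableSet_and (measurableSet_lt ?_ ?_) (measurableSet_lt ?_ ?_)).nullMeasurableSet
      <;> fun_prop
  · refine (measurableSet_and (measurableSet_lt ?_ ?_) (measurableSet_le ?_ ?_)).nullMeasurableSet
      <;> fun_prop

/-! ### Overlaps of enlarged discs and radical axes -/

section Overlap
variable {V : Type*} [NormedAddCommGroup V] [InnerProductSpace ℝ V]

/-- Among three vectors, some two enclose an angle of at most `2π / 3`. -/
theorem exists_inner_ge_neg_half (a b c : V) :
    -(1 / 2 * (‖a‖ * ‖b‖)) ≤ inner ℝ a b ∨ -(1 / 2 * (‖a‖ * ‖c‖)) ≤ inner ℝ a c ∨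
      -(1 / 2 * (‖b‖ * ‖c‖)) ≤ inner ℝ b c := by
  by_contra! ⟨h1, h2, h3⟩
  have ha : 0 < ‖a‖ := norm_pos_iff.2 (by rintro rfl; simp at h1)
  have hb : 0 < ‖b‖ := norm_pos_iff.2 (by rintro rfl; simp at h1)
  have hc : 0 < ‖c‖ := norm_pos_iff.2 (by rintro rfl; simp at h2)
  -- This is `‖a‖ ‖b‖ ‖c‖` times the sum of the three unit vectors. If all three cosines were below
  -- `-1/2`, its squared norm would be negative.
  set x := (‖b‖ * ‖c‖) • a + (‖a‖ * ‖c‖) • b + (‖a‖ * ‖b‖) • c with hx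
  have h := real_inner_self_nonneg (x := x)
  simp only [hx, inner_add_left, inner_add_right, real_inner_smul_left, real_inner_smul_right,
    real_inner_self_eq_norm_sq, norm_smul, norm_mul, norm_norm, real_inner_comm a b, real_inner_comm a c,
    real_inner_comm b c] at h
  have e1 := mul_lt_mul_of_pos_left h1 (show 0 < ‖a‖ * ‖b‖ * ‖c‖ ^ 2 by positivity)
  have e2 := mul_lt_mul_of_pos_left h2 (show 0 < ‖a‖ * ‖c‖ * ‖b‖ ^ 2 by positivity)
  have e3 := mul_lt_mul_of_pos_left h3 (show 0 < ‖b‖ * ‖c‖ * ‖a‖ ^ 2 by positivity)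
  nlinarith

/-- Law of cosines: with `m = max s t`, `‖a - b‖² ≤ ‖a‖² + ‖b‖² + ‖a‖ ‖b‖ < 3 * (4 / 3) * m²`. This
is where the enlargement factor `2 / √3` is sharp. -/
theorem norm_sub_lt_of_inner_ge {a b : V} {s t : ℝ}
    (h : -(1 / 2 * (‖a‖ * ‖b‖)) ≤ inner ℝ a b) (hs : 0 < s) (ha : ‖a‖ ≤ 2 / √3 * s)
    (hb : ‖b‖ < 2 / √3 * t) : ‖a - b‖ < 2 * max s t := by
  set m := max s t with hm
  have hm0 : 0 < m := lt_max_of_lt_left hs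
  have ha' : ‖a‖ ≤ 2 / √3 * m := ha.trans (by gcongr; exact le_max_left _ _)
  have hb' : ‖b‖ < 2 / √3 * m := hb.trans_le (by gcongr; exact le_max_right _ _)
  have hR : (2 / √3 * m) ^ 2 = 4 / 3 * m ^ 2 := by
    rw [mul_pow, div_pow, Real.sq_sqrt (by norm_num)]; norm_num
  have h1 : ‖a‖ ^ 2 ≤ 4 / 3 * m ^ 2 := hR ▸ pow_le_pow_left₀ (norm_nonneg _) ha' 2
  have h2 : ‖b‖ ^ 2 < 4 / 3 * m ^ 2 := hR ▸ pow_lt_pow_left₀ hb' (norm_nonneg _) two_ne_zero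
  have h3 : ‖a‖ * ‖b‖ ≤ 4 / 3 * m ^ 2 := by
    rw [← hR, sq]; exact mul_le_mul ha' hb'.le (norm_nonneg _) (by positivity)
  refine lt_of_pow_lt_pow_left₀ 2 (by positivity) ?_
  rw [norm_sub_sq_real]
  nlinarith

/-- Discs about three points, each of radius `2 / √3` times a number that does not exceed half
the distance to the other points, have no common point. -/
theorem not_three_overlap {p x y z : V} {r s t : ℝ} (hr : 0 < r) (hs : 0 < s)
    (hxy : 2 * max r s ≤ ‖x - y‖) (hxz : 2 * max r t ≤ ‖x - z‖) (hyz : 2 * max s t ≤ ‖y - z‖)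
    (hx : ‖p - x‖ ≤ 2 / √3 * r) (hy : ‖p - y‖ < 2 / √3 * s) (hz : ‖p - z‖ < 2 / √3 * t) :
    False := by
  have key : ∀ u v : V, ‖(p - u) - (p - v)‖ = ‖u - v‖ := fun u v => by
    rw [sub_sub_sub_cancel_left, norm_sub_rev]
  rcases exists_inner_ge_neg_half (p - x) (p - y) (p - z) with h | h | h
  · have := norm_sub_lt_of_inner_ge h hr hx hy
    rw [key] at this; linarith
  · have := norm_sub_lt_of_inner_ge h hr hx hz
    rw [key] at this; linarith
  · have := norm_sub_lt_of_inner_ge h hs hy.le hz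
    rw [key] at this; linarith

/-- The distance from the centre of a disc of radius `2 / √3 * a` to the radical axis with a disc
of radius `2 / √3 * b`, whose centre lies at distance `d`. -/
noncomputable def axisDist (a b d : ℝ) : ℝ := (d ^ 2 + 4 / 3 * a ^ 2 - 4 / 3 * b ^ 2) / (2 * d)

/-- The left side is `√3 / 2` times the disc radius, that is, `a`. So a chord on a radical axis
subtends an angle of at most `π / 3`, as required by the cap estimate. -/
theorem axisDist_ge {a b d : ℝ} (ha : 0 < a) (hb : 0 < b) (h : 2 * max a b ≤ d) :
    √3 / 2 * (2 / √3 * a) ≤ axisDist a b d := by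
  have h1 : 2 * a ≤ d := le_trans (by gcongr; exact le_max_left _ _) h
  have h2 : 2 * b ≤ d := le_trans (by gcongr; exact le_max_right _ _) h
  have e : √3 / 2 * (2 / √3 * a) = a := by field_simp
  rw [e, axisDist, le_div_iff₀ (by linarith)]
  rcases le_total a b with hab | hab <;> nlinarith

/-- The point `p` is at least as close, in power distance, to `y` as to `x`. -/
theorem power_le_iff {p x y : V} {a b : ℝ} (hxy : x ≠ y) :
    ‖p - y‖ ^ 2 - 4 / 3 * b ^ 2 ≤ ‖p - x‖ ^ 2 - 4 / 3 * a ^ 2 ↔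
      axisDist a b ‖x - y‖ ≤ inner ℝ (‖y - x‖⁻¹ • (y - x)) (p - x) := by
  have hd : 0 < ‖y - x‖ := norm_pos_iff.2 (sub_ne_zero.2 hxy.symm)
  have e : p - y = (p - x) - (y - x) := by abel
  rw [e, norm_sub_sq_real (p - x) (y - x), norm_sub_rev x y, axisDist, real_inner_smul_left,
    div_le_iff₀ (by positivity), ← real_inner_comm (p - x) (y - x)]
  have : ‖y - x‖⁻¹ * inner ℝ (y - x) (p - x) * (2 * ‖y - x‖) = 2 * inner ℝ (y - x) (p - x) := by
    field_simp
  rw [this]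
  constructor <;> intro <;> linarith

theorem power_lt_iff {p x y : V} {a b : ℝ} (hxy : x ≠ y) :
    ‖p - y‖ ^ 2 - 4 / 3 * b ^ 2 < ‖p - x‖ ^ 2 - 4 / 3 * a ^ 2 ↔
      axisDist a b ‖x - y‖ < inner ℝ (‖y - x‖⁻¹ • (y - x)) (p - x) := by
  have hd : 0 < ‖y - x‖ := norm_pos_iff.2 (sub_ne_zero.2 hxy.symm)
  have e : p - y = (p - x) - (y - x) := by abel
  rw [e, norm_sub_sq_real (p - x) (y - x), norm_sub_rev x y, axisDist, real_inner_smul_left,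
    div_lt_iff₀ (by positivity), ← real_inner_comm (p - x) (y - x)]
  have : ‖y - x‖⁻¹ * inner ℝ (y - x) (p - x) * (2 * ‖y - x‖) = 2 * inner ℝ (y - x) (p - x) := by
    field_simp
  rw [this]
  constructor <;> intro <;> linarith

/-- The sector of the disc of radius `2 / √3 * a` about `x` that is spanned by the chord on the
radical axis with the disc of radius `2 / √3 * b` about `y`. -/
def sector (x y : V) (a b : ℝ) : Set V :=
  {p | ‖p - x‖ < 2 / √3 * a ∧ axisDist a b ‖x - y‖ / (2 / √3 * a) * ‖p - x‖ <
    inner ℝ (‖y - x‖⁻¹ • (y - x)) (p - x)}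

/-- The cap cut off by the same chord. -/
def cap (x y : V) (a b : ℝ) : Set V :=
  {p | ‖p - x‖ < 2 / √3 * a ∧ axisDist a b ‖x - y‖ ≤ inner ℝ (‖y - x‖⁻¹ • (y - x)) (p - x)}

/-- The angular condition is invariant under scaling from `x`, so a common point can be pushed
radially to the circle about `x`. There the power with respect to `x` vanishes, hence the powers
with respect to `y` and `z` are negative, and the point lies in three discs. It lies only on the
boundary of the first, which `not_three_overlap` permits. -/
theorem disjoint_sector {x y z : V} {r s t : ℝ} (hr : 0 < r) (hs : 0 < s) (ht : 0 < t)
    (hxy : 2 * max r s ≤ ‖x - y‖) (hxz : 2 * max r t ≤ ‖x - z‖) (hyz : 2 * max s t ≤ ‖y - z‖) :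
    Disjoint (sector x y r s) (sector x z r t) := by
  rw [Set.disjoint_left]
  rintro p ⟨h1, h2⟩ ⟨-, h3⟩
  have hR : 0 < 2 / √3 * r := by positivity
  have hp : 0 < ‖p - x‖ := by
    rw [norm_pos_iff]; intro h0; simp [h0] at h2
  set q := x + ((2 / √3 * r) / ‖p - x‖) • (p - x) with hq
  have hqx : q - x = ((2 / √3 * r) / ‖p - x‖) • (p - x) := by rw [hq, add_sub_cancel_left]
  have hqn : ‖q - x‖ = 2 / √3 * r := by
    rw [hqx, norm_smul, Real.norm_of_nonneg (by positivity)]; field_simp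
  have main : ∀ (w : V) (u : ℝ), 0 < u → 2 * max r u ≤ ‖x - w‖ →
      axisDist r u ‖x - w‖ / (2 / √3 * r) * ‖p - x‖ < inner ℝ (‖w - x‖⁻¹ • (w - x)) (p - x) →
      ‖q - w‖ < 2 / √3 * u := by
    intro w u hu hxw h
    have hne : x ≠ w := by
      rintro rfl
      have : r ≤ max r u := le_max_left _ _
      simp at hxw; linarith
    have h4 : axisDist r u ‖x - w‖ < inner ℝ (‖w - x‖⁻¹ • (w - x)) (q - x) := by
      rw [hqx, real_inner_smul_right, div_mul_eq_mul_div, lt_div_iff₀ hp]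
      rw [div_mul_eq_mul_div, div_lt_iff₀ hR] at h
      linarith
    rw [← power_lt_iff hne, hqn, mul_pow, div_pow, Real.sq_sqrt (by norm_num)] at h4
    refine lt_of_pow_lt_pow_left₀ 2 (by positivity) ?_
    rw [mul_pow, div_pow, Real.sq_sqrt (by norm_num)]
    linarith
  exact not_three_overlap hr hs hxy hxz hyz hqn.le (main y s hs hxy h2) (main z t ht hxz h3)

end Overlap

/-! ### The packing lemma -/

theorem measurableSet_sector (x y : Plane) (a b : ℝ) : MeasurableSet (sector x y a b) := by
  refine measurableSet_and (measurableSet_lt ?_ ?_) (measurableSet_lt ?_ ?_) <;> fun_prop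

theorem volume_cap_le {x y : Plane} {a b : ℝ} (ha : 0 < a) (hb : 0 < b)
    (h : 2 * max a b ≤ ‖x - y‖) :
    volume (cap x y a b) ≤ ENNReal.ofReal capRatio * volume (sector x y a b) := by
  have hd : 0 < ‖y - x‖ := by
    rw [norm_sub_rev]; exact lt_of_lt_of_le (by positivity) h
  refine volume_cap_le_sector_plane (by positivity) (axisDist_ge ha hb h) x _ ?_
  rw [norm_smul, norm_inv, norm_norm, inv_mul_cancel₀ hd.ne']

/-- **Packing lemma.** If each `r i` is at most half the distance from the point `x i` to the other
points, then the discs of radius `2 / √3 * r i` contain disjoint cells of area at least the area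
`2 √3 (r i)²` of the regular hexagon of inradius `r i`. -/
theorem exists_cells {ι : Type*} (s : Finset ι) (x : ι → Plane) (r : ι → ℝ)
    (hr : ∀ i ∈ s, 0 < r i)
    (hsep : ∀ i ∈ s, ∀ j ∈ s, i ≠ j → 2 * max (r i) (r j) ≤ ‖x i - x j‖) :
    ∃ C : ι → Set Plane, (∀ i ∈ s, MeasurableSet (C i)) ∧
      (∀ i ∈ s, C i ⊆ Metric.ball (x i) (2 / √3 * r i)) ∧ (s : Set ι).PairwiseDisjoint C ∧
      ∀ i ∈ s, ENNReal.ofReal (2 * √3 * r i ^ 2) ≤ volume (C i) := by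
  classical
  -- Power distance to the disc of radius `2 / √3 * r i`; strict minimality defines the cell.
  set P : ι → Plane → ℝ := fun i p => ‖p - x i‖ ^ 2 - 4 / 3 * r i ^ 2 with hP
  refine ⟨fun i => Metric.ball (x i) (2 / √3 * r i) ∩ ⋂ j ∈ s.erase i, {p | P i p < P j p},
    fun i _ => ?_, fun i _ => Set.inter_subset_left, ?_, ?_⟩
  · refine measurableSet_ball.inter (Finset.measurableSet_biInter _ fun j _ => ?_)
    apply measurableSet_lt <;> fun_prop
  · intro i hi j hj hij
    refine Set.disjoint_left.2 fun p hpi hpj => ?_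
    have h1 := Set.mem_iInter₂.1 hpi.2 j (Finset.mem_erase.2 ⟨hij.symm, hj⟩)
    have h2 := Set.mem_iInter₂.1 hpj.2 i (Finset.mem_erase.2 ⟨hij, hi⟩)
    exact lt_asymm (show P i p < P j p from h1) h2
  · intro i hi
    have hri := hr i hi
    set B := Metric.ball (x i) (2 / √3 * r i) with hB
    set C := B ∩ ⋂ j ∈ s.erase i, {p | P i p < P j p} with hC
    have hne : ∀ j ∈ s.erase i, x i ≠ x j := by
      intro j hj h
      obtain ⟨h1, h2⟩ := Finset.mem_erase.1 hj
      have := hsep i hi j h2 h1.symm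
      have h3 : r i ≤ max (r i) (r j) := le_max_left _ _
      simp [h] at this; linarith
    have hcover : B ⊆ C ∪ ⋃ j ∈ s.erase i, cap (x i) (x j) (r i) (r j) := by
      intro p hp
      by_cases h : p ∈ ⋂ j ∈ s.erase i, {p | P i p < P j p}
      · exact Or.inl ⟨hp, h⟩
      · right
        simp only [Set.mem_iInter, not_forall] at h
        obtain ⟨j, hj, hlt⟩ := h
        refine Set.mem_iUnion₂.2 ⟨j, hj, ?_, (power_le_iff (hne j hj)).1 (not_lt.1 hlt)⟩
        rwa [hB, mem_ball_iff_norm] at hp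
    have hdisj : (↑(s.erase i) : Set ι).PairwiseDisjoint
        fun j => sector (x i) (x j) (r i) (r j) := by
      intro j hj k hk hjk
      obtain ⟨h1, h2⟩ := Finset.mem_erase.1 (Finset.mem_coe.1 hj)
      obtain ⟨h3, h4⟩ := Finset.mem_erase.1 (Finset.mem_coe.1 hk)
      exact disjoint_sector hri (hr j h2) (hr k h4) (hsep i hi j h2 h1.symm)
        (hsep i hi k h4 h3.symm) (hsep j h2 k h4 hjk)
    have hcaps : volume (⋃ j ∈ s.erase i, cap (x i) (x j) (r i) (r j)) ≤
        ENNReal.ofReal capRatio * volume B := by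
      calc _ ≤ ∑ j ∈ s.erase i, volume (cap (x i) (x j) (r i) (r j)) :=
            measure_biUnion_finset_le _ _
        _ ≤ ∑ j ∈ s.erase i,
            ENNReal.ofReal capRatio * volume (sector (x i) (x j) (r i) (r j)) := by
            refine Finset.sum_le_sum fun j hj => ?_
            obtain ⟨h1, h2⟩ := Finset.mem_erase.1 hj
            exact volume_cap_le hri (hr j h2) (hsep i hi j h2 h1.symm)
        _ = ENNReal.ofReal capRatio *
            volume (⋃ j ∈ s.erase i, sector (x i) (x j) (r i) (r j)) := by
            rw [← Finset.mul_sum, measure_biUnion_finset hdisj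
              fun j _ => measurableSet_sector _ _ _ _]
        _ ≤ _ := by
            gcongr
            refine Set.iUnion₂_subset fun j _ p hp => ?_
            rw [hB, mem_ball_iff_norm]; exact hp.1
    have hBv : volume B = ENNReal.ofReal (4 / 3 * r i ^ 2 * Real.pi) := by
      rw [hB, EuclideanSpace.volume_ball_fin_two, ← ENNReal.ofReal_pow (by positivity),
        ← ENNReal.ofReal_mul (by positivity), mul_pow, div_pow, Real.sq_sqrt (by norm_num)]
      norm_num
    have hsum : volume B ≤ volume C + ENNReal.ofReal capRatio * volume B :=
      (measure_mono hcover).trans ((measure_union_le _ _).trans (by gcongr))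
    -- A hexagon occupies the fraction `3 √3 / (2 π) = 1 - capRatio` of its circumscribed disc.
    have e : 4 / 3 * r i ^ 2 * Real.pi =
        2 * √3 * r i ^ 2 + capRatio * (4 / 3 * r i ^ 2 * Real.pi) := by
      have := Real.pi_ne_zero
      rw [capRatio]; field_simp; ring
    have hk := capRatio_nonneg
    rw [hBv, ← ENNReal.ofReal_mul hk] at hsum
    have hfin : ENNReal.ofReal (capRatio * (4 / 3 * r i ^ 2 * Real.pi)) ≠ ∞ := by simp
    rw [← ENNReal.add_le_add_iff_right hfin, ← ENNReal.ofReal_add (by positivity)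
      (mul_nonneg hk (by positivity)), ← e]
    exact hsum

/-! ### Dual formula for the relative entropy -/

section Duality
variable {α : Type*} [MeasurableSpace α]

/-- The functional `φ ↦ ∫ φ dμ + 1 - ∫ exp φ dν`, whose supremum is the entropy of `μ` relative
to `ν`. -/
noncomputable def dualEntropy (μ ν : Measure α) (φ : α → ℝ) : ℝ :=
  ∫ x, φ x ∂μ + 1 - ∫ x, Real.exp (φ x) ∂ν

theorem integrable_of_abs_le {ν : Measure α} [IsFiniteMeasure ν] {φ : α → ℝ} (hφ : Measurable φ)
    {M : ℝ} (hM : ∀ x, |φ x| ≤ M) : Integrable φ ν :=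
  Integrable.of_bound hφ.aestronglyMeasurable M (ae_of_all _ hM)

theorem integrable_exp_of_abs_le {ν : Measure α} [IsFiniteMeasure ν] {φ : α → ℝ}
    (hφ : Measurable φ) {M : ℝ} (hM : ∀ x, |φ x| ≤ M) : Integrable (fun x => Real.exp (φ x)) ν :=
  integrable_of_abs_le (M := Real.exp M) (by fun_prop) fun x => by
    rw [Real.abs_exp]; exact Real.exp_le_exp.2 (le_of_abs_le (hM x))

/-- A large constant on a `ν`-null set charged by `μ` raises `∫ φ dμ` without changing `∫ exp φ dν`.
-/
theorem exists_lt_dualEntropy_of_not_ac {μ ν : Measure α} [IsFiniteMeasure μ] [IsFiniteMeasure ν]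
    (h : ¬ μ ≪ ν) (a : ℝ) :
    ∃ φ : α → ℝ, Measurable φ ∧ (∃ M, ∀ x, |φ x| ≤ M) ∧ a < dualEntropy μ ν φ := by
  obtain ⟨A, hA, hν, hμ⟩ : ∃ A, MeasurableSet A ∧ ν A = 0 ∧ μ A ≠ 0 := by
    by_contra! hcon
    exact h (Measure.AbsolutelyContinuous.mk fun s hs h0 => hcon s hs h0)
  have hpos : 0 < μ.real A := ENNReal.toReal_pos hμ (measure_ne_top _ _)
  obtain ⟨M, hM0, hM⟩ : ∃ M : ℝ, 0 ≤ M ∧ a - 1 + ν.real Set.univ < M * μ.real A := by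
    refine ⟨(|a - 1 + ν.real Set.univ| + 1) / μ.real A, by positivity, ?_⟩
    rw [div_mul_cancel₀ _ hpos.ne']
    linarith [le_abs_self (a - 1 + ν.real Set.univ)]
  refine ⟨A.indicator fun _ => M, measurable_const.indicator hA, ⟨M, fun x => ?_⟩, ?_⟩
  · by_cases hx : x ∈ A <;> simp [hx, hM0, abs_of_nonneg]
  · have h1 : ∫ x, Real.exp (A.indicator (fun _ => M) x) ∂ν = ∫ _, (1 : ℝ) ∂ν := by
      refine integral_congr_ae ?_
      have : ∀ᵐ x ∂ν, x ∉ A := measure_eq_zero_iff_ae_notMem.1 hν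
      filter_upwards [this] with x hx
      simp [hx]
    rw [dualEntropy, h1, integral_indicator_const _ hA]
    simp only [smul_eq_mul, integral_const, mul_one]
    linarith [mul_comm M (μ.real A)]

theorem neg_mul_log_le_one {t : ℝ} (ht : 0 ≤ t) : -(t * Real.log t) ≤ 1 := by
  have := Real.negMulLog_le_one_sub_self ht
  rw [Real.negMulLog] at this; linarith

/-- The logarithm of `t` truncated to `[-n, n]`. -/
noncomputable def truncLog (n : ℕ) (t : ℝ) : ℝ := min (n : ℝ) (Real.log (max t (Real.exp (-n))))

theorem abs_truncLog_le (n : ℕ) (t : ℝ) : |truncLog n t| ≤ n := by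
  rw [abs_le, truncLog]
  refine ⟨le_min (by linarith [n.cast_nonneg (α := ℝ)]) ?_, min_le_left _ _⟩
  rw [Real.le_log_iff_exp_le (lt_max_of_lt_right (Real.exp_pos _))]
  exact le_max_right _ _

theorem measurable_truncLog (n : ℕ) : Measurable (truncLog n) := by
  unfold truncLog; fun_prop

theorem exp_truncLog_le {t : ℝ} (ht : 0 ≤ t) (n : ℕ) :
    Real.exp (truncLog n t) ≤ t + Real.exp (-n) := by
  have h : 0 < max t (Real.exp (-n)) := lt_max_of_lt_right (Real.exp_pos _)
  calc _ ≤ Real.exp (Real.log (max t (Real.exp (-n)))) := Real.exp_le_exp.2 (min_le_right _ _)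
    _ = max t (Real.exp (-n)) := Real.exp_log h
    _ ≤ _ := max_le_add_of_nonneg ht (Real.exp_pos _).le

theorem mul_min_log_le {t : ℝ} (ht : 0 ≤ t) (n : ℕ) :
    t * min (n : ℝ) (Real.log t) ≤ t * truncLog n t := by
  rcases ht.eq_or_lt with rfl | h
  · simp
  · refine mul_le_mul_of_nonneg_left (min_le_min le_rfl ?_) ht
    exact Real.log_le_log h (le_max_left _ _)

theorem mul_min_log_abs_le {t : ℝ} (ht : 0 ≤ t) (n : ℕ) :
    |t * min (n : ℝ) (Real.log t)| ≤ t * n + 1 := by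
  have h1 := neg_mul_log_le_one ht
  have hn := n.cast_nonneg (α := ℝ)
  rw [abs_le]
  constructor
  · rcases min_choice (n : ℝ) (Real.log t) with h | h <;> rw [h] <;> nlinarith [mul_nonneg ht hn]
  · nlinarith [mul_le_mul_of_nonneg_left (min_le_left (n : ℝ) (Real.log t)) ht]

/-- Cutting the logarithm at `n ≥ 0` from above does not touch the negative part, so only positive
parts need a limit. -/
theorem ofReal_neg_mul_min_log {t : ℝ} (ht : 0 ≤ t) (n : ℕ) :
    ENNReal.ofReal (-(t * min (n : ℝ) (Real.log t))) = ENNReal.ofReal (-(t * Real.log t)) := by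
  rcases le_total (n : ℝ) (Real.log t) with h | h
  · have hn := n.cast_nonneg (α := ℝ)
    rw [min_eq_left h, ENNReal.ofReal_of_nonpos, ENNReal.ofReal_of_nonpos]
    · nlinarith [mul_nonneg ht (hn.trans h)]
    · nlinarith [mul_nonneg ht hn]
  · rw [min_eq_right h]

/-- The formal maximizer is `log ρ`; its truncation at level `n` is bounded. The exponential
integral then exceeds `∫ ρ = 1` by at most `exp (-n) ν(α)`, and `∫ φ dμ` is bounded below by `∫ ρ
min (n, log ρ) dν`, whose positive part increases to that of the entropy. -/
theorem exists_lt_dualEntropy_of_ac {μ ν : Measure α} [IsProbabilityMeasure μ] [IsFiniteMeasure ν]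
    (h : μ ≪ ν) {ρ : α → ℝ} (hρ : ρ = fun x => (μ.rnDeriv ν x).toReal) {a : ℝ}
    (ha : (a : EReal) < ((∫⁻ x, ENNReal.ofReal (ρ x * Real.log (ρ x)) ∂ν : ℝ≥0∞) : EReal)
      - ((∫⁻ x, ENNReal.ofReal (-(ρ x * Real.log (ρ x))) ∂ν : ℝ≥0∞) : EReal)) :
    ∃ φ : α → ℝ, Measurable φ ∧ (∃ M, ∀ x, |φ x| ≤ M) ∧ a < dualEntropy μ ν φ := by
  have hρm : Measurable ρ := by rw [hρ]; fun_prop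
  have hρ0 : ∀ x, 0 ≤ ρ x := fun x => by rw [hρ]; exact ENNReal.toReal_nonneg
  have hρi : Integrable ρ ν := by rw [hρ]; exact Measure.integrable_toReal_rnDeriv
  have hρ1 : ∫ x, ρ x ∂ν = 1 := by
    rw [hρ, Measure.integral_toReal_rnDeriv h]; simp
  set P := ∫⁻ x, ENNReal.ofReal (ρ x * Real.log (ρ x)) ∂ν with hP
  set Q := ∫⁻ x, ENNReal.ofReal (-(ρ x * Real.log (ρ x))) ∂ν with hQ
  have hQtop : Q ≠ ∞ := by
    refine ne_top_of_le_ne_top (measure_ne_top ν Set.univ) ?_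
    calc Q ≤ ∫⁻ _, 1 ∂ν := by
          refine lintegral_mono fun x => ?_
          rw [← ENNReal.ofReal_one]
          exact ENNReal.ofReal_le_ofReal (neg_mul_log_le_one (hρ0 x))
      _ = _ := by simp
  have hQ' : (Q : EReal) = ((Q.toReal : ℝ) : EReal) := (EReal.coe_ennreal_toReal hQtop).symm
  have hlt : ((a + Q.toReal : ℝ) : EReal) < P := by
    rw [hQ'] at ha
    rw [EReal.coe_add]
    exact EReal.add_lt_of_lt_sub ha
  obtain ⟨b, hb1, hb2⟩ := EReal.lt_iff_exists_real_btwn.1 hlt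
  have hb1' : a + Q.toReal < b := by exact_mod_cast hb1
  set f : ℕ → α → ℝ := fun n x => ρ x * min (n : ℝ) (Real.log (ρ x)) with hf
  have hfm : ∀ n, Measurable (f n) := fun n => by rw [hf]; fun_prop
  have hlim : Tendsto (fun n => ∫⁻ x, ENNReal.ofReal (f n x) ∂ν) atTop (𝓝 P) := by
    refine lintegral_tendsto_of_tendsto_of_monotone (fun n => by fun_prop)
      (ae_of_all _ fun x m n hmn => ?_) (ae_of_all _ fun x => ?_)
    · refine ENNReal.ofReal_le_ofReal (mul_le_mul_of_nonneg_left ?_ (hρ0 x))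
      exact min_le_min (by exact_mod_cast hmn) le_rfl
    · refine tendsto_const_nhds.congr' ?_
      filter_upwards [eventually_ge_atTop ⌈Real.log (ρ x)⌉₊] with n hn
      rw [hf]; dsimp only
      rw [min_eq_right ((Nat.le_ceil _).trans (by exact_mod_cast hn))]
  have hlim2 : Tendsto (fun n : ℕ => Real.exp (-n) * ν.real Set.univ) atTop (𝓝 0) := by
    rw [← zero_mul (ν.real Set.univ)]
    exact (Real.tendsto_exp_neg_atTop_nhds_zero.comp tendsto_natCast_atTop_atTop).mul_const _
  have hev : ∀ᶠ n in atTop, (b : EReal) < ((∫⁻ x, ENNReal.ofReal (f n x) ∂ν : ℝ≥0∞) : EReal) :=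
    ((continuous_coe_ennreal_ereal.tendsto P).comp hlim).eventually_const_lt hb2
  obtain ⟨n, hn1, hn2⟩ := (hev.and (hlim2.eventually_lt_const
    (show (0 : ℝ) < b - (a + Q.toReal) by linarith))).exists
  have hfi : Integrable (f n) ν := by
    refine Integrable.mono' ((hρi.mul_const (n : ℝ)).add (integrable_const (1 : ℝ)))
      (hfm n).aestronglyMeasurable (ae_of_all _ fun x => mul_min_log_abs_le (hρ0 x) n)
  have hφm : Measurable fun x => truncLog n (ρ x) := (measurable_truncLog n).comp hρm
  refine ⟨fun x => truncLog n (ρ x), hφm, ⟨n, fun x => abs_truncLog_le n _⟩, ?_⟩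
  have h1 : b - Q.toReal ≤ ∫ x, truncLog n (ρ x) ∂μ := by
    rw [← integral_rnDeriv_smul h]
    calc b - Q.toReal ≤ ∫ x, f n x ∂ν := by
          rw [integral_eq_lintegral_pos_part_sub_lintegral_neg_part hfi]
          simp only [hf, ofReal_neg_mul_min_log (hρ0 _)]
          have : ∫⁻ x, ENNReal.ofReal (f n x) ∂ν ≠ ∞ := hfi.lintegral_lt_top.ne
          have hn3 : (b : EReal) < (((∫⁻ x, ENNReal.ofReal (f n x) ∂ν).toReal : ℝ) : EReal) := by
            rwa [EReal.coe_ennreal_toReal this]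
          have hn4 := EReal.coe_lt_coe_iff.1 hn3
          rw [← hQ]
          linarith
      _ ≤ _ := by
          refine integral_mono hfi ?_ fun x => ?_
          · refine (integrable_rnDeriv_smul_iff h).2 ?_
            exact integrable_of_abs_le hφm fun x => abs_truncLog_le n _
          · have := mul_min_log_le (hρ0 x) n
            rw [← show ρ x = (μ.rnDeriv ν x).toReal from congrFun hρ x, smul_eq_mul]
            exact this
  have h2 : ∫ x, Real.exp (truncLog n (ρ x)) ∂ν ≤ 1 + Real.exp (-n) * ν.real Set.univ := by
    calc _ ≤ ∫ x, (ρ x + Real.exp (-n)) ∂ν :=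
          integral_mono (integrable_exp_of_abs_le hφm fun x => abs_truncLog_le n _)
            (hρi.add (integrable_const _)) fun x => exp_truncLog_le (hρ0 x) n
      _ = _ := by
          rw [integral_add hρi (integrable_const _), hρ1]
          simp [mul_comm]
  rw [dualEntropy]
  linarith

theorem exp_le_exp_add_mul_abs {x y M : ℝ} (hy : y ≤ M) :
    Real.exp y ≤ Real.exp x + Real.exp M * |x - y| := by
  have h1 := Real.add_one_le_exp (x - y)
  have h2 : Real.exp x = Real.exp y * Real.exp (x - y) := by rw [← Real.exp_add]; congr 1; ring
  have h3 : Real.exp y * (y - x) ≤ Real.exp M * |x - y| := by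
    rw [abs_sub_comm]
    exact (mul_le_mul_of_nonneg_left (le_abs_self _) (Real.exp_pos _).le).trans
      (mul_le_mul_of_nonneg_right (Real.exp_le_exp.2 hy) (abs_nonneg _))
  nlinarith [Real.exp_pos y]

/-- Bounded continuous functions are dense in `L¹(μ + ν)`. Clipping to `[-M, M]` does not increase
the distance to `φ`, and on that range `exp` is Lipschitz with constant `exp M`; so both integrals
change little. -/
theorem exists_continuous_lt_dualEntropy [TopologicalSpace α] [NormalSpace α] [BorelSpace α]
    {μ ν : Measure α} [IsFiniteMeasure μ] [IsFiniteMeasure ν] [(μ + ν).WeaklyRegular]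
    {φ : α → ℝ} (hφ : Measurable φ) {M : ℝ} (hM : ∀ x, |φ x| ≤ M) {a : ℝ}
    (ha : a < dualEntropy μ ν φ) :
    ∃ ψ : α → ℝ, Continuous ψ ∧ (∀ x, |ψ x| ≤ M) ∧ a < dualEntropy μ ν ψ := by
  rcases isEmpty_or_nonempty α with he | ⟨⟨x₀⟩⟩
  · exact ⟨φ, continuous_of_discreteTopology, hM, ha⟩
  have hM0 : 0 ≤ M := (abs_nonneg _).trans (hM x₀)
  obtain ⟨δ, hδ, hδa⟩ : ∃ δ > 0, (1 + Real.exp M) * δ < dualEntropy μ ν φ - a := by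
    refine ⟨(dualEntropy μ ν φ - a) / (2 * (1 + Real.exp M)), ?_, ?_⟩
    · have := Real.exp_pos M
      exact div_pos (by linarith) (by positivity)
    · have := Real.exp_pos M
      field_simp
      linarith
  obtain ⟨g, hg, -⟩ := (integrable_of_abs_le (ν := μ + ν) hφ hM
    ).exists_boundedContinuous_integral_sub_le hδ
  set ψ : α → ℝ := fun x => max (-M) (min M (g x)) with hψ
  have hψc : Continuous ψ := by rw [hψ]; fun_prop
  have hψM : ∀ x, |ψ x| ≤ M := fun x =>
    abs_le.2 ⟨le_max_left _ _, max_le (by linarith) (min_le_left _ _)⟩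
  have hψφ : ∀ x, |φ x - ψ x| ≤ ‖φ x - g x‖ := by
    intro x
    obtain ⟨h1, h2⟩ := abs_le.1 (hM x)
    rw [Real.norm_eq_abs, hψ]
    dsimp only
    rcases le_total M (g x) with h | h
    · rw [min_eq_left h, max_eq_right (by linarith), abs_sub_comm, abs_sub_comm (φ x),
        abs_of_nonneg (by linarith), abs_of_nonneg (by linarith)]
      linarith
    · rw [min_eq_right h]
      rcases le_total (-M) (g x) with h' | h'
      · rw [max_eq_right h']
      · rw [max_eq_left h', abs_of_nonneg (by linarith), abs_of_nonneg (by linarith)]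
        linarith
  have hψm : Measurable ψ := hψc.measurable
  have hdi : ∀ η : Measure α, IsFiniteMeasure η → Integrable (fun x => |φ x - ψ x|) η :=
    fun η _ => ((integrable_of_abs_le hφ hM).sub (integrable_of_abs_le hψm hψM)).abs
  have htot : ∫ x, |φ x - ψ x| ∂μ + ∫ x, |φ x - ψ x| ∂ν ≤ δ := by
    rw [← integral_add_measure (hdi μ inferInstance) (hdi ν inferInstance)]
    refine (integral_mono (hdi _ inferInstance) ?_ hψφ).trans hg
    have hgi : Integrable (fun x => g x) (μ + ν) := g.integrable _
    exact ((integrable_of_abs_le hφ hM).sub hgi).norm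
  have hμ0 : 0 ≤ ∫ x, |φ x - ψ x| ∂μ := integral_nonneg fun x => abs_nonneg _
  have hν0 : 0 ≤ ∫ x, |φ x - ψ x| ∂ν := integral_nonneg fun x => abs_nonneg _
  refine ⟨ψ, hψc, hψM, ?_⟩
  have h1 : ∫ x, φ x ∂μ ≤ ∫ x, ψ x ∂μ + ∫ x, |φ x - ψ x| ∂μ := by
    rw [← integral_add (integrable_of_abs_le hψm hψM) (hdi μ inferInstance)]
    refine integral_mono (integrable_of_abs_le hφ hM)
      ((integrable_of_abs_le hψm hψM).add (hdi μ inferInstance)) fun x => ?_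
    have := le_abs_self (φ x - ψ x)
    dsimp only; linarith
  have h2 : ∫ x, Real.exp (ψ x) ∂ν ≤
      ∫ x, Real.exp (φ x) ∂ν + Real.exp M * ∫ x, |φ x - ψ x| ∂ν := by
    rw [← integral_const_mul, ← integral_add (integrable_exp_of_abs_le hφ hM)
      ((hdi ν inferInstance).const_mul _)]
    exact integral_mono (integrable_exp_of_abs_le hψm hψM)
      ((integrable_exp_of_abs_le hφ hM).add ((hdi ν inferInstance).const_mul _))
      fun x => exp_le_exp_add_mul_abs (le_of_abs_le (hψM x))
  have h3 : Real.exp M * ∫ x, |φ x - ψ x| ∂ν ≤ Real.exp M * δ := by gcongr; linarith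
  rw [dualEntropy] at ha hδa ⊢
  linarith

end Duality

theorem exists_continuous_lt_dualEntropy_of_lt_entropy {Ω : Set Plane} [IsFiniteMeasure (area Ω)]
    (μ : ProbabilityMeasure Ω) {a : ℝ} (ha : (a : EReal) < entropy μ) :
    ∃ ψ : Ω → ℝ, Continuous ψ ∧ (∃ M, ∀ x, |ψ x| ≤ M) ∧
      a < dualEntropy (μ : Measure Ω) (area Ω) ψ := by
  obtain ⟨φ, hφ, ⟨M, hM⟩, h⟩ : ∃ φ : Ω → ℝ, Measurable φ ∧ (∃ M, ∀ x, |φ x| ≤ M) ∧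
      a < dualEntropy (μ : Measure Ω) (area Ω) φ := by
    by_cases hac : (μ : Measure Ω) ≪ area Ω
    · rw [entropy] at ha
      simp only [if_pos hac] at ha
      exact exists_lt_dualEntropy_of_ac hac rfl ha
    · exact exists_lt_dualEntropy_of_not_ac hac a
  obtain ⟨ψ, h1, h2, h3⟩ := exists_continuous_lt_dualEntropy hφ hM h
  exact ⟨ψ, h1, ⟨M, h2⟩, h3⟩

/-! ### The lower bound -/

variable {Ω : Set Plane}

theorem area_apply (hΩ : IsCompact Ω) (s : Set Ω) : area Ω s = volume (Subtype.val '' s) :=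
  comap_subtype_coe_apply hΩ.measurableSet _ _

theorem area_preimage (hΩ : IsCompact Ω) (s : Set Plane) :
    area Ω (Subtype.val ⁻¹' s) = volume (s ∩ Ω) := by
  rw [area_apply hΩ, Subtype.image_preimage_coe, Set.inter_comm]

theorem isFiniteMeasure_area (hΩ : IsCompact Ω) : IsFiniteMeasure (area Ω) := by
  refine ⟨?_⟩
  rw [area_apply hΩ, Subtype.coe_image_univ]
  exact hΩ.measure_lt_top

/-- Each hexagon area is replaced by the area of the disjoint cell, on which `φ` drops by at most
`ω` from its value at the centre. Cells may leave `Ω`; what sticks out lies in a thin collar and is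
estimated by the second term. -/
theorem sum_area_mul_exp_le (hΩ : IsCompact Ω) (s : Finset Ω) (r : Ω → ℝ) {η ω M : ℝ}
    (hr : ∀ x ∈ s, 0 < r x) (hrη : ∀ x ∈ s, r x ≤ η)
    (hsep : ∀ x ∈ s, ∀ y ∈ s, x ≠ y → 2 * max (r x) (r y) ≤ dist x y)
    {φ : Ω → ℝ} (hφ : Measurable φ) (hM : ∀ x, |φ x| ≤ M)
    (hω : ∀ x y, dist x y < 2 / √3 * η → φ x ≤ φ y + ω) :
    ∑ x ∈ s, 2 * √3 * r x ^ 2 * Real.exp (φ x) ≤ Real.exp ω * ∫ x, Real.exp (φ x) ∂(area Ω) +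
      Real.exp M * volume.real (Metric.cthickening (2 / √3 * η) Ω \ Ω) := by
  have := isFiniteMeasure_area hΩ
  obtain ⟨C, hCm, hCb, hCd, hCv⟩ := exists_cells s (fun x : Ω => (x : Plane)) r hr
    (fun x hx y hy hxy => (hsep x hx y hy hxy).trans_eq (by
      rw [Subtype.dist_eq, dist_eq_norm]))
  have hei := integrable_exp_of_abs_le (ν := area Ω) hφ hM
  set E := Metric.cthickening (2 / √3 * η) Ω \ Ω with hE
  have hEtop : volume E ≠ ∞ :=
    measure_ne_top_of_subset Set.sdiff_subset hΩ.cthickening.measure_lt_top.ne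
  have hCtop : ∀ x ∈ s, volume (C x) ≠ ∞ := fun x hx =>
    measure_ne_top_of_subset (hCb x hx) measure_ball_lt_top.ne
  set D : Ω → Set Ω := fun x => Subtype.val ⁻¹' C x with hD
  have hDm : ∀ x ∈ s, MeasurableSet (D x) := fun x hx => measurable_subtype_coe (hCm x hx)
  have hDd : (s : Set Ω).PairwiseDisjoint D := fun x hx y hy hxy =>
    (hCd hx hy hxy).preimage _
  have hmain : ∀ x ∈ s, 2 * √3 * r x ^ 2 * Real.exp (φ x) ≤
      Real.exp ω * ∫ y in D x, Real.exp (φ y) ∂(area Ω) +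
        Real.exp M * volume.real (C x \ Ω) := by
    intro x hx
    have h1 : 2 * √3 * r x ^ 2 ≤ volume.real (C x) :=
      (ENNReal.ofReal_le_iff_le_toReal (hCtop x hx)).1 (hCv x hx)
    have h2 : volume.real (C x) = (area Ω).real (D x) + volume.real (C x \ Ω) := by
      rw [Measure.real, Measure.real, Measure.real, hD, area_preimage hΩ,
        ← ENNReal.toReal_add, measure_inter_add_sdiff _ hΩ.measurableSet]
      · exact measure_ne_top_of_subset Set.inter_subset_left (hCtop x hx)
      · exact measure_ne_top_of_subset Set.sdiff_subset (hCtop x hx)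
    have h3 : (area Ω).real (D x) * Real.exp (φ x) ≤
        Real.exp ω * ∫ y in D x, Real.exp (φ y) ∂(area Ω) := by
      have : (area Ω).real (D x) * Real.exp (φ x) =
          ∫ _ in D x, Real.exp (φ x) ∂(area Ω) := by simp
      rw [this, ← integral_const_mul]
      refine setIntegral_mono_on (integrable_const _).integrableOn
        (hei.const_mul _).integrableOn (hDm x hx) fun y hy => ?_
      rw [← Real.exp_add]
      refine Real.exp_le_exp.2 ?_
      have hy2 : (y : Plane) ∈ Metric.ball (x : Plane) (2 / √3 * r x) := hCb x hx hy
      have hy3 : dist x y < 2 / √3 * η := by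
        rw [dist_comm]
        exact lt_of_lt_of_le hy2 (by gcongr; exact hrη x hx)
      linarith [hω x y hy3]
    have h4 : volume.real (C x \ Ω) * Real.exp (φ x) ≤
        Real.exp M * volume.real (C x \ Ω) := by
      rw [mul_comm]
      gcongr
      exact le_of_abs_le (hM x)
    calc _ ≤ volume.real (C x) * Real.exp (φ x) := by gcongr
      _ = (area Ω).real (D x) * Real.exp (φ x) +
          volume.real (C x \ Ω) * Real.exp (φ x) := by rw [h2]; ring
      _ ≤ _ := add_le_add h3 h4
  refine (Finset.sum_le_sum hmain).trans ?_
  rw [Finset.sum_add_distrib, ← Finset.mul_sum, ← Finset.mul_sum]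
  gcongr
  · rw [← integral_biUnion_finset s hDm hDd fun x _ => hei.integrableOn]
    exact setIntegral_le_integral hei (ae_of_all _ fun x => (Real.exp_pos _).le)
  · rw [← measureReal_biUnion_finset
      (fun x hx y hy hxy => (hCd hx hy hxy).mono Set.sdiff_subset Set.sdiff_subset)
      (fun x hx => (hCm x hx).diff hΩ.measurableSet)
      (fun x hx => measure_ne_top_of_subset Set.sdiff_subset (hCtop x hx))]
    · refine measureReal_mono (Set.iUnion₂_subset fun x hx p hp => ⟨?_, hp.2⟩) hEtop
      have h5 := hCb x hx hp.1
      refine Metric.mem_cthickening_of_dist_le p x _ _ x.2 ?_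
      exact (le_of_lt h5).trans (by gcongr; exact hrη x hx)

section HalfMinDist
variable (X : Configuration Ω)

theorem two_mul_halfMinDist_le {x y : Ω} (hy : y ∈ X.1) (hxy : x ≠ y) :
    2 * halfMinDist X x ≤ dist x y := by
  have := Metric.infDist_le_dist_of_mem (x := x)
    (show y ∈ (X.1 : Set Ω) \ {x} from ⟨hy, fun h => hxy (Set.mem_singleton_iff.1 h).symm⟩)
  rw [halfMinDist]; linarith

theorem two_mul_max_halfMinDist_le {x y : Ω} (hx : x ∈ X.1) (hy : y ∈ X.1) (hxy : x ≠ y) :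
    2 * max (halfMinDist X x) (halfMinDist X y) ≤ dist x y := by
  rw [mul_max_of_nonneg _ _ (by norm_num)]
  refine max_le (two_mul_halfMinDist_le X hy hxy) ?_
  rw [dist_comm]; exact two_mul_halfMinDist_le X hx hxy.symm

theorem nonempty_diff_of_two_le (hX : 2 ≤ numPoints X) (x : Ω) :
    ((X.1 : Set Ω) \ {x}).Nonempty := by
  obtain ⟨y, hy, hyx⟩ := Finset.exists_mem_ne (s := X.1) hX x
  exact ⟨y, hy, hyx⟩

theorem le_halfMinDist (hX : 2 ≤ numPoints X) (x : Ω) {d : ℝ}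
    (h : ∀ y ∈ X.1, y ≠ x → 2 * d ≤ dist x y) : d ≤ halfMinDist X x := by
  have := (Metric.le_infDist (nonempty_diff_of_two_le X hX x) (x := x) (r := 2 * d)).2
    fun y hy => h y hy.1 hy.2
  rw [halfMinDist]; linarith

theorem halfMinDist_pos (hX : 2 ≤ numPoints X) (x : Ω) : 0 < halfMinDist X x := by
  have hc : IsClosed ((X.1 : Set Ω) \ {x}) := (X.1.finite_toSet.sdiff).isClosed
  have := (hc.notMem_iff_infDist_pos (nonempty_diff_of_two_le X hX x)).1
    (show x ∉ (X.1 : Set Ω) \ {x} from fun h => h.2 rfl)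
  rw [halfMinDist]; linarith

end HalfMinDist

theorem integral_empirical (X : Configuration Ω) (f : Ω → ℝ) :
    ∫ x, f x ∂(empirical X : Measure Ω) = (numPoints X : ℝ)⁻¹ * ∑ x ∈ X.1, f x := by
  have : (empirical X : Measure Ω) =
    (numPoints X : ℝ≥0∞)⁻¹ • ∑ x ∈ X.1, Measure.dirac x := rfl
  rw [this, integral_smul_measure, integral_finsetSum_measure]
  · simp
  · intro x _
    exact integrable_dirac (by simp)

/-- This is `log t ≤ t - 1` at `t = 2 √3 N s² exp φ` with `s = min r η`. The last term on the left
pays for replacing `r` by `s`. -/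
theorem neg_log_ge {r η φ : ℝ} {N : ℝ} (hr : 0 < r) (hη : 0 < η) (hN : 0 < N) :
    φ + 1 - N * (2 * √3 * min r η ^ 2 * Real.exp φ) - 2 * r ^ 2 / η ^ 2 ≤
      -2 * Real.log r - Real.log (2 * √3 * N) := by
  set s := min r η with hs
  have hs0 : 0 < s := lt_min hr hη
  have h1 : Real.log r ≤ Real.log s + r ^ 2 / η ^ 2 := by
    rcases le_total r η with h | h
    · rw [hs, min_eq_left h]
      have : 0 ≤ r ^ 2 / η ^ 2 := by positivity
      linarith
    · rw [hs, min_eq_right h]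
      have h2 := Real.log_le_sub_one_of_pos (show 0 < r / η by positivity)
      rw [Real.log_div hr.ne' hη.ne'] at h2
      have h3 : r / η ≤ r ^ 2 / η ^ 2 + 1 := by
        rw [← div_pow]; nlinarith [sq_nonneg (r / η - 1)]
      linarith
  have h2 := Real.log_le_sub_one_of_pos
    (show 0 < 2 * √3 * N * s ^ 2 * Real.exp φ by positivity)
  rw [Real.log_mul (by positivity) (by positivity), Real.log_exp,
    Real.log_mul (by positivity) (by positivity), Real.log_pow] at h2
  push_cast at h2
  have h3 : 2 * r ^ 2 / η ^ 2 = 2 * (r ^ 2 / η ^ 2) := by ring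
  rw [h3]
  linarith

theorem discreteEntropy_eq_sum (X : Configuration Ω) :
    discreteEntropy X = (numPoints X : ℝ)⁻¹ * ∑ x ∈ X.1,
      (-2 * Real.log (halfMinDist X x) - Real.log (2 * √3 * (numPoints X : ℝ))) := by
  have hN : (numPoints X : ℝ) ≠ 0 := Nat.cast_ne_zero.2 (Finset.card_pos.2 X.2).ne'
  rw [discreteEntropy, Finset.sum_sub_distrib, Finset.sum_const, ← Finset.mul_sum, nsmul_eq_mul,
    ← show numPoints X = X.1.card from rfl]
  field_simp

theorem discreteEntropy_ge (X : Configuration Ω) (hX : 2 ≤ numPoints X) (φ : Ω → ℝ) {η : ℝ}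
    (hη : 0 < η) :
    ∫ x, φ x ∂(empirical X : Measure Ω) + 1
      - ∑ x ∈ X.1, 2 * √3 * min (halfMinDist X x) η ^ 2 * Real.exp (φ x)
      - (numPoints X : ℝ)⁻¹ * (2 / η ^ 2 * ∑ x ∈ X.1, halfMinDist X x ^ 2) ≤
      discreteEntropy X := by
  have hN : (0 : ℝ) < numPoints X := Nat.cast_pos.2 (Finset.card_pos.2 X.2)
  rw [discreteEntropy_eq_sum, integral_empirical]
  have h := Finset.sum_le_sum fun x (_ : x ∈ X.1) =>
    neg_log_ge (φ := φ x) (halfMinDist_pos X hX x) hη hN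
  have h2 := mul_le_mul_of_nonneg_left h (inv_nonneg.2 hN.le)
  refine le_trans (le_of_eq ?_) h2
  rw [Finset.sum_sub_distrib, Finset.sum_sub_distrib, Finset.sum_add_distrib, Finset.sum_const,
    ← Finset.mul_sum, nsmul_eq_mul, ← show numPoints X = X.1.card from rfl, ← Finset.sum_div,
    ← Finset.mul_sum]
  field_simp

/-- The packing estimate with `φ = 0` and no smallness: all radii are at most `D`, a bound for the
norm on `Ω`. -/
theorem exists_sum_sq_halfMinDist_le (hΩ : IsCompact Ω) :
    ∃ K : ℝ, ∀ X : Configuration Ω, 2 ≤ numPoints X → ∑ x ∈ X.1, halfMinDist X x ^ 2 ≤ K := by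
  obtain ⟨D, hD⟩ := hΩ.isBounded.exists_norm_le
  refine ⟨(Real.exp 0 * ∫ x, Real.exp ((fun _ => (0 : ℝ)) x) ∂(area Ω) +
      Real.exp 0 * volume.real (Metric.cthickening (2 / √3 * D) Ω \ Ω)) / (2 * √3),
    fun X hX => ?_⟩
  rw [le_div_iff₀ (by positivity), Finset.sum_mul]
  refine le_trans (le_of_eq (Finset.sum_congr rfl fun x _ => ?_))
    (sum_area_mul_exp_le hΩ X.1 (halfMinDist X) (η := D) (fun x _ => halfMinDist_pos X hX x) ?_
      (fun x hx y hy hxy => two_mul_max_halfMinDist_le X hx hy hxy)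
      measurable_const (by simp) (by simp))
  · simp; ring
  · intro x _
    obtain ⟨y, hy, hyx⟩ := nonempty_diff_of_two_le X hX x
    have h1 := two_mul_halfMinDist_le X hy (x := x) (fun h => hyx h.symm)
    have h2 : dist x y ≤ ‖(x : Plane)‖ + ‖(y : Plane)‖ := by
      rw [Subtype.dist_eq]; exact dist_le_norm_add_norm _ _
    linarith [hD x x.2, hD y y.2]

theorem tendsto_volume_cthickening_diff (hΩ : IsCompact Ω) :
    Tendsto (fun δ => volume.real (Metric.cthickening δ Ω \ Ω)) (𝓝[>] 0) (𝓝 0) := by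
  have h1 : Tendsto (fun δ => volume.real (Metric.cthickening δ Ω) - volume.real Ω)
      (𝓝[>] 0) (𝓝 0) := by
    have : Tendsto (fun δ => volume.real (Metric.cthickening δ Ω)) (𝓝[>] 0)
        (𝓝 (volume.real Ω)) := ((ENNReal.tendsto_toReal hΩ.measure_lt_top.ne).comp
      (tendsto_measure_cthickening_of_isCompact hΩ)).mono_left nhdsWithin_le_nhds
    simpa using this.sub_const (volume.real Ω)
  refine h1.congr fun δ => ?_
  rw [measureReal_sdiff (Metric.self_subset_cthickening _) hΩ.measurableSet
    hΩ.cthickening.measure_lt_top.ne]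

/-- Serves both the liminf inequality and the lower half of convergence along the recovery sequence.
-/
theorem eventually_discreteEntropy_ge (hΩ : IsCompact Ω) {ι : Type*} {l : Filter ι}
    (X : ι → Configuration Ω) (μ : ProbabilityMeasure Ω)
    (hX : Tendsto (fun i => numPoints (X i)) l atTop)
    (hμ : Tendsto (fun i => empirical (X i)) l (𝓝 μ)) {a : ℝ} (ha : (a : EReal) < entropy μ) :
    ∀ᶠ i in l, a ≤ discreteEntropy (X i) := by
  have := isFiniteMeasure_area hΩ
  have : CompactSpace Ω := isCompact_iff_compactSpace.1 hΩ
  obtain ⟨ψ, hψ, ⟨M, hM⟩, hlt⟩ := exists_continuous_lt_dualEntropy_of_lt_entropy μ ha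
  obtain ⟨K, hK⟩ := exists_sum_sq_halfMinDist_le hΩ
  set I := ∫ x, Real.exp (ψ x) ∂(area Ω) with hI
  rw [dualEntropy, ← hI] at hlt
  set J := ∫ x, ψ x ∂(μ : Measure Ω) with hJ
  -- Four errors of size `ε`: oscillation of `ψ` on cells, the collar of `Ω`, truncation of large
  -- radii, and weak convergence.
  obtain ⟨ε, hε, hε4⟩ : ∃ ε > 0, a + 4 * ε < J + 1 - I :=
    ⟨(J + 1 - I - a) / 8, by linarith, by linarith⟩
  obtain ⟨ω, hω, hωI⟩ : ∃ ω > 0, Real.exp ω * I < I + ε := by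
    have : Tendsto (fun ω => Real.exp ω * I) (𝓝[>] 0) (𝓝 (Real.exp 0 * I)) :=
      ((Real.continuous_exp.tendsto 0).mul_const _).mono_left nhdsWithin_le_nhds
    rw [Real.exp_zero, one_mul] at this
    obtain ⟨ω, h1, h2⟩ :=
      ((this.eventually_lt_const (show I < I + ε by linarith)).and self_mem_nhdsWithin).exists
    exact ⟨ω, h2, h1⟩
  obtain ⟨δ, hδ, hδω⟩ := Metric.uniformContinuous_iff.1
    (CompactSpace.uniformContinuous_of_continuous hψ) ω hω
  obtain ⟨η, hη, hηδ, hηv⟩ : ∃ η > 0, 2 / √3 * η < δ ∧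
      Real.exp M * volume.real (Metric.cthickening (2 / √3 * η) Ω \ Ω) < ε := by
    have h1 : Tendsto (fun δ => Real.exp M * volume.real (Metric.cthickening δ Ω \ Ω))
        (𝓝[>] 0) (𝓝 (Real.exp M * 0)) := (tendsto_volume_cthickening_diff hΩ).const_mul _
    rw [mul_zero] at h1
    obtain ⟨t, ht1, ht2, ht3⟩ := ((h1.eventually_lt_const hε).and
      ((eventually_lt_nhds hδ).filter_mono nhdsWithin_le_nhds |>.and self_mem_nhdsWithin)).exists
    have ht4 : 0 < t := ht3
    have e : 2 / √3 * (√3 / 2 * t) = t := by field_simp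
    exact ⟨√3 / 2 * t, by positivity, by rw [e]; exact ht2, by rw [e]; exact ht1⟩
  have hN : Tendsto (fun i => (numPoints (X i) : ℝ)⁻¹ * (2 / η ^ 2 * K)) l (𝓝 0) := by
    have h1 : Tendsto (fun i => (numPoints (X i) : ℝ)⁻¹) l (𝓝 0) :=
      tendsto_inv_atTop_zero.comp (tendsto_natCast_atTop_atTop.comp hX)
    simpa using h1.mul_const (2 / η ^ 2 * K)
  have hint : Tendsto (fun i => ∫ x, ψ x ∂(empirical (X i) : Measure Ω)) l (𝓝 J) :=
    ProbabilityMeasure.tendsto_iff_forall_integral_tendsto.1 hμ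
      (BoundedContinuousFunction.mkOfCompact ⟨ψ, hψ⟩)
  filter_upwards [hX.eventually_ge_atTop 2, hN.eventually_lt_const hε,
    hint.eventually_const_lt (show J - ε < J by linarith)] with i h2 hNi hinti
  have h3 := discreteEntropy_ge (X i) h2 ψ hη
  have h4 : ∑ x ∈ (X i).1, 2 * √3 * min (halfMinDist (X i) x) η ^ 2 * Real.exp (ψ x) ≤
      Real.exp ω * I + Real.exp M * volume.real (Metric.cthickening (2 / √3 * η) Ω \ Ω) := by
    refine sum_area_mul_exp_le hΩ _ _ (fun x _ => lt_min (halfMinDist_pos _ h2 x) hη)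
      (fun x _ => min_le_right _ _) (fun x hx y hy hxy => ?_) hψ.measurable hM
      fun x y hxy => ?_
    · refine le_trans ?_ (two_mul_max_halfMinDist_le (X i) hx hy hxy)
      gcongr <;> exact min_le_left _ _
    · have h5 := hδω (hxy.trans hηδ)
      rw [Real.dist_eq] at h5
      linarith [(abs_lt.1 h5).2]
  have h5 : (numPoints (X i) : ℝ)⁻¹ * (2 / η ^ 2 * ∑ x ∈ (X i).1, halfMinDist (X i) x ^ 2) ≤
      (numPoints (X i) : ℝ)⁻¹ * (2 / η ^ 2 * K) := by
    gcongr; exact hK _ h2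
  linarith

/-! ### Lattice points in measurable sets -/

theorem exists_finset_le_card_of_le_tsum_indicator {ι : Type*} {S : Set ι} {c : ℝ≥0∞}
    (hc : c ≠ ∞) (h : c ≤ ∑' i, S.indicator (fun _ => (1 : ℝ≥0∞)) i) :
    ∃ s : Finset ι, ↑s ⊆ S ∧ c ≤ s.card := by
  classical
  by_cases hS : S.Finite
  · refine ⟨hS.toFinset, by simp, h.trans (le_of_eq ?_)⟩
    rw [tsum_eq_sum (s := hS.toFinset) (fun i hi => by simp_all),
      Finset.sum_congr rfl fun i hi => Set.indicator_of_mem (hS.mem_toFinset.1 hi) _]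
    simp
  · obtain ⟨n, hn⟩ := ENNReal.exists_nat_gt hc
    obtain ⟨s, hs, hcard⟩ := Set.Infinite.exists_subset_card_eq hS n
    exact ⟨s, hs, by rw [hcard]; exact hn.le⟩

/-- Some translate of the integer lattice has at least `volume B` points in `B`. -/
theorem exists_finset_sub_int_le_card {n : ℕ} (B : Set (Fin n → ℝ)) (hB : MeasurableSet B)
    (hBv : volume B ≠ ∞) :
    ∃ s : Finset (Fin n → ℝ), ↑s ⊆ B ∧ volume B ≤ s.card ∧
      ∀ x ∈ s, ∀ y ∈ s, ∀ i, ∃ m : ℤ, x i - y i = m := by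
  classical
  set b := Pi.basisFun ℝ (Fin n) with hb
  set F := ZSpan.fundamentalDomain b with hF
  have hfd := ZSpan.isAddFundamentalDomain b (volume : Measure (Fin n → ℝ))
  have : VAddInvariantMeasure (Submodule.span ℤ (Set.range b)) (Fin n → ℝ) volume :=
    ⟨fun c t ht => (measurePreserving_add_left volume (c : Fin n → ℝ)).measure_preimage
      ht.nullMeasurableSet⟩
  have hFv : volume F = 1 := by
    rw [hF, hb, ZSpan.fundamentalDomain_pi_basisFun]
    simp [Real.volume_pi_Ico]
  set f : (Fin n → ℝ) → ℝ≥0∞ := B.indicator fun _ => 1 with hf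
  have hfm : Measurable f := measurable_const.indicator hB
  -- Blichfeldt's averaging: the number of lattice translates of `x` in `B`, averaged over a
  -- fundamental domain of volume `1`, is `volume B`; some `x` attains at least the average.
  have h1 : volume B = ∫⁻ x in F,
      ∑' g : (Submodule.span ℤ (Set.range b)), f (g +ᵥ x) := by
    rw [lintegral_tsum fun g => ?_, ← hfd.lintegral_eq_tsum'', hf, lintegral_indicator hB]
    · simp
    · exact (hfm.comp (measurable_const_vadd g)).aemeasurable
  obtain ⟨x, -, hx⟩ := exists_setLAverage_le (μ := volume) (s := F)
    (f := fun x => ∑' g : (Submodule.span ℤ (Set.range b)), f (g +ᵥ x)) (by simp [hFv])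
    (ZSpan.fundamentalDomain_measurableSet b).nullMeasurableSet (by rwa [← h1])
  rw [setLAverage_eq, ← h1, hFv, div_one] at hx
  obtain ⟨s, hs, hcard⟩ := exists_finset_le_card_of_le_tsum_indicator
    (S := {g : (Submodule.span ℤ (Set.range b)) | (g +ᵥ x : Fin n → ℝ) ∈ B}) hBv hx
  have hint : ∀ (g : Submodule.span ℤ (Set.range b)) (i), ∃ m : ℤ, (g : Fin n → ℝ) i = m := by
    intro g i
    obtain ⟨m, hm⟩ := (b.mem_span_iff_repr_mem ℤ (g : Fin n → ℝ)).1 g.2 i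
    exact ⟨m, by simpa [hb] using hm.symm⟩
  refine ⟨s.image fun g => (g +ᵥ x : Fin n → ℝ), ?_, ?_, ?_⟩
  · intro y hy
    obtain ⟨g, hg, rfl⟩ := Finset.mem_image.1 (Finset.mem_coe.1 hy)
    exact hs hg
  · have hinj : Function.Injective fun g : Submodule.span ℤ (Set.range b) =>
        (g +ᵥ x : Fin n → ℝ) := fun g g' h => Subtype.ext (add_right_cancel h)
    rwa [Finset.card_image_of_injective _ hinj]
  · intro y hy z hz i
    obtain ⟨g, -, rfl⟩ := Finset.mem_image.1 hy
    obtain ⟨g', -, rfl⟩ := Finset.mem_image.1 hz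
    obtain ⟨m, hm⟩ := hint g i
    obtain ⟨m', hm'⟩ := hint g' i
    refine ⟨m - m', ?_⟩
    have e : ∀ h : Submodule.span ℤ (Set.range b),
        (h +ᵥ x : Fin n → ℝ) i = (h : Fin n → ℝ) i + x i := fun h => rfl
    rw [e, e, hm, hm']; push_cast; ring

theorem one_le_triangular_form {m n : ℤ} (h : ¬(m = 0 ∧ n = 0)) : 1 ≤ m ^ 2 + m * n + n ^ 2 := by
  by_contra! hlt
  have h1 : m ^ 2 + m * n + n ^ 2 ≤ 0 := by omega
  have h2 : n = 0 := by
    by_contra hn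
    have : 0 < n ^ 2 := by positivity
    nlinarith [sq_nonneg (2 * m + n)]
  subst h2
  exact h ⟨by nlinarith, rfl⟩

/-- A suitable translate of the triangular lattice with spacing `d` has at least
`volume K / (√3 / 2 * d²)` points in `K`. -/
theorem exists_separated_finset {K : Set Plane} (hK : MeasurableSet K) (hKv : volume K ≠ ∞)
    {d : ℝ} (hd : 0 < d) :
    ∃ s : Finset Plane, ↑s ⊆ K ∧ volume.real K ≤ s.card * (√3 / 2 * d ^ 2) ∧
      ∀ x ∈ s, ∀ y ∈ s, x ≠ y → d ≤ dist x y := by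
  classical
  -- The columns span the triangular lattice: the image of `(m, n)` has squared length `d² (m² + m n
  -- + n²)`.
  set M : Matrix (Fin 2) (Fin 2) ℝ := !![d, d / 2; 0, √3 / 2 * d] with hM
  have hdet : M.det = √3 / 2 * d ^ 2 := by rw [hM, Matrix.det_fin_two_of]; ring
  have hdet0 : 0 < M.det := by rw [hdet]; positivity
  set e := (EuclideanSpace.volume_preserving_symm_measurableEquiv_toLp (Fin 2)).symm with he
  set K' : Set (Fin 2 → ℝ) := (MeasurableEquiv.toLp 2 (Fin 2 → ℝ)) ⁻¹' K with hK'
  have hK'm : MeasurableSet K' := (MeasurableEquiv.toLp 2 (Fin 2 → ℝ)).measurable hK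
  have hK'v : volume K' = volume K := e.measure_preimage hK.nullMeasurableSet
  have hTm : Measurable (Matrix.toLin' M) :=
    (Matrix.toLin' M).continuous_of_finiteDimensional.measurable
  set B : Set (Fin 2 → ℝ) := Matrix.toLin' M ⁻¹' K' with hB
  have hBv : volume B = ENNReal.ofReal (M.det)⁻¹ * volume K := by
    rw [hB, ← Measure.map_apply hTm hK'm,
      Real.map_matrix_volume_pi_eq_smul_volume_pi hdet0.ne', Measure.smul_apply, hK'v,
      abs_of_pos (by positivity), smul_eq_mul]
  obtain ⟨s, hs, hcard, hint⟩ := exists_finset_sub_int_le_card B (hTm hK'm)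
    (by rw [hBv]; exact ENNReal.mul_ne_top ENNReal.ofReal_ne_top hKv)
  set T : (Fin 2 → ℝ) → Plane := fun w => WithLp.toLp 2 (Matrix.toLin' M w) with hT
  have hdist : ∀ x ∈ s, ∀ y ∈ s, x ≠ y → d ≤ dist (T x) (T y) := by
    intro x hx y hy hxy
    obtain ⟨m, hm⟩ := hint x hx y hy 0
    obtain ⟨n, hn⟩ := hint x hx y hy 1
    have hmn : ¬(m = 0 ∧ n = 0) := by
      rintro ⟨rfl, rfl⟩
      apply hxy
      ext i
      fin_cases i
      · simpa [sub_eq_zero] using hm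
      · simpa [sub_eq_zero] using hn
    have h1 : (1 : ℝ) ≤ (m : ℝ) ^ 2 + m * n + (n : ℝ) ^ 2 := by
      exact_mod_cast one_le_triangular_form hmn
    rw [EuclideanSpace.dist_eq]
    refine Real.le_sqrt_of_sq_le ?_
    simp only [Fin.sum_univ_two, Real.dist_eq, sq_abs, hT, hM, Matrix.toLin'_apply,
      Matrix.mulVec, dotProduct, Matrix.of_apply, Matrix.cons_val_zero, Matrix.cons_val_one,
      Matrix.cons_val', Matrix.cons_val_fin_one]
    have e1 : d * x 0 + d / 2 * x 1 - (d * y 0 + d / 2 * y 1) = d * (m + n / 2) := by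
      rw [← hm, ← hn]; ring
    have e2 : 0 * x 0 + √3 / 2 * d * x 1 - (0 * y 0 + √3 / 2 * d * y 1) = √3 * (d * n / 2) := by
      rw [← hn]; ring
    rw [e1, e2, mul_pow √3, Real.sq_sqrt (by norm_num)]
    nlinarith [mul_le_mul_of_nonneg_left h1 (sq_nonneg d)]
  have hinj : Set.InjOn T s := by
    intro x hx y hy hxy
    by_contra hne
    have := hdist x hx y hy hne
    rw [hxy, dist_self] at this
    linarith
  refine ⟨s.image T, ?_, ?_, ?_⟩
  · intro p hp
    obtain ⟨w, hw, rfl⟩ := Finset.mem_image.1 (Finset.mem_coe.1 hp)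
    exact hs hw
  · rw [Finset.card_image_of_injOn hinj, ← hdet]
    have h2 : volume.real B ≤ s.card := by
      rw [Measure.real]
      exact ENNReal.toReal_le_of_le_ofReal (by positivity) (by simpa using hcard)
    have h3 : volume.real B = (M.det)⁻¹ * volume.real K := by
      rw [Measure.real, hBv, ENNReal.toReal_mul, ENNReal.toReal_ofReal (by positivity)]; rfl
    rw [h3, inv_mul_le_iff₀ hdet0] at h2
    linarith
  · intro p hp q hq hpq
    obtain ⟨w, hw, rfl⟩ := Finset.mem_image.1 hp
    obtain ⟨z, hz, rfl⟩ := Finset.mem_image.1 hq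
    exact hdist w hw z hz fun h => hpq (by rw [h])

/-! ### Finite entropy and Jensen's inequality -/

/-- The density of `μ` with respect to the Lebesgue measure on `Ω`. -/
noncomputable def density (μ : ProbabilityMeasure Ω) (x : Ω) : ℝ :=
  ((μ : Measure Ω).rnDeriv (area Ω) x).toReal

theorem absolutelyContinuous_of_entropy_lt_top {μ : ProbabilityMeasure Ω} (h : entropy μ < ⊤) :
    (μ : Measure Ω) ≪ area Ω := by
  by_contra hac
  simp [entropy, hac] at h

theorem integrable_density_mul_log (hΩ : IsCompact Ω) {μ : ProbabilityMeasure Ω}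
    (h : entropy μ < ⊤) :
    Integrable (fun x => density μ x * Real.log (density μ x)) (area Ω) ∧
      entropy μ = ((∫ x, density μ x * Real.log (density μ x) ∂(area Ω) : ℝ) : EReal) := by
  have := isFiniteMeasure_area hΩ
  have hac := absolutelyContinuous_of_entropy_lt_top h
  have hm : Measurable (density μ) := by unfold density; fun_prop
  have h0 : ∀ x, 0 ≤ density μ x := fun x => ENNReal.toReal_nonneg
  have he : entropy μ =
      ((∫⁻ x, ENNReal.ofReal (density μ x * Real.log (density μ x)) ∂(area Ω) : ℝ≥0∞) : EReal)
        - ((∫⁻ x, ENNReal.ofReal (-(density μ x * Real.log (density μ x))) ∂(area Ω) : ℝ≥0∞) :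
          EReal) := by
    rw [entropy]; simp only [if_pos hac]; rfl
  set P := ∫⁻ x, ENNReal.ofReal (density μ x * Real.log (density μ x)) ∂(area Ω) with hP
  set Q := ∫⁻ x, ENNReal.ofReal (-(density μ x * Real.log (density μ x))) ∂(area Ω) with hQ
  have hQtop : Q ≠ ∞ := by
    refine ne_top_of_le_ne_top (measure_ne_top (area Ω) Set.univ) ?_
    calc Q ≤ ∫⁻ _, 1 ∂(area Ω) := by
          refine lintegral_mono fun x => ?_
          rw [← ENNReal.ofReal_one]
          exact ENNReal.ofReal_le_ofReal (neg_mul_log_le_one (h0 x))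
      _ = _ := by simp
  have hPtop : P ≠ ∞ := by
    intro hPt
    rw [he, hPt, ← EReal.coe_ennreal_toReal hQtop] at h
    simp at h
  have hi : Integrable (fun x => density μ x * Real.log (density μ x)) (area Ω) := by
    refine ⟨by fun_prop, ?_⟩
    rw [hasFiniteIntegral_iff_norm]
    have hle : ∀ t : ℝ, ENNReal.ofReal ‖t‖ ≤ ENNReal.ofReal t + ENNReal.ofReal (-t) := by
      intro t
      rcases le_total 0 t with ht | ht
      · rw [Real.norm_of_nonneg ht]; exact le_self_add
      · rw [Real.norm_of_nonpos ht]; exact le_add_self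
    refine (lintegral_mono fun x => hle _).trans_lt ?_
    rw [lintegral_add_left (by fun_prop)]
    exact ENNReal.add_lt_top.2 ⟨hPtop.lt_top, hQtop.lt_top⟩
  refine ⟨hi, ?_⟩
  rw [he, integral_eq_lintegral_pos_part_sub_lintegral_neg_part hi, EReal.coe_sub,
    EReal.coe_ennreal_toReal hPtop, EReal.coe_ennreal_toReal hQtop]

/-- The left side is the tangent at `a` of the convex function `t ↦ t log t`. -/
theorem mul_log_ge_tangent {t a : ℝ} (ht : 0 ≤ t) (ha : 0 < a) :
    t * (1 + Real.log a) - a ≤ t * Real.log t := by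
  rcases ht.eq_or_lt with rfl | h
  · simpa using ha.le
  · have h1 := Real.log_le_sub_one_of_pos (show 0 < a / t by positivity)
    rw [Real.log_div ha.ne' h.ne'] at h1
    have h2 := mul_le_mul_of_nonneg_left h1 ht
    have h3 : t * (a / t - 1) = a - t := by field_simp
    rw [h3] at h2
    linarith

/-- Jensen's inequality for the entropy on a measurable set. -/
theorem mul_log_le_setIntegral (hΩ : IsCompact Ω) {μ : ProbabilityMeasure Ω} (h : entropy μ < ⊤)
    (A : Set Ω) :
    (μ : Measure Ω).real A * Real.log ((μ : Measure Ω).real A / (area Ω).real A) ≤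
      ∫ x in A, density μ x * Real.log (density μ x) ∂(area Ω) := by
  have := isFiniteMeasure_area hΩ
  have hac := absolutelyContinuous_of_entropy_lt_top h
  obtain ⟨hi, -⟩ := integrable_density_mul_log hΩ h
  set p := (μ : Measure Ω).real A with hp
  set v := (area Ω).real A with hv
  set I := ∫ x in A, density μ x * Real.log (density μ x) ∂(area Ω) with hI
  have hdi : Integrable (density μ) (area Ω) := Measure.integrable_toReal_rnDeriv
  have hd : ∫ x in A, density μ x ∂(area Ω) = p :=
    Measure.setIntegral_toReal_rnDeriv hac A
  have key : ∀ a > 0, p * (1 + Real.log a) - a * v ≤ I := by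
    intro a ha
    have h1 : ∫ x in A, (density μ x * (1 + Real.log a) - a) ∂(area Ω) ≤ I :=
      integral_mono ((hdi.mul_const _).sub (integrable_const _)).integrableOn hi.integrableOn
        fun x => mul_log_ge_tangent ENNReal.toReal_nonneg ha
    rw [integral_sub (hdi.mul_const _).integrableOn (integrable_const _), integral_mul_const,
      hd] at h1
    simpa [mul_comm a, hv] using h1
  have hp0 : 0 ≤ p := measureReal_nonneg
  have hv0 : 0 ≤ v := measureReal_nonneg
  -- For `p > 0` the optimal tangent point is `a = p / v`. For `p = 0` the bound `-a v ≤ I` for all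
  -- small `a > 0` forces `I ≥ 0`.
  rcases hp0.eq_or_lt with hp1 | hp1
  · rw [← hp1, zero_mul]
    by_contra! hneg
    have h2 := key (-I / (v + 1)) (div_pos (by linarith) (by linarith))
    rw [← hp1, zero_mul, zero_sub, neg_div, neg_mul, neg_neg, div_mul_eq_mul_div,
      div_le_iff₀ (by linarith)] at h2
    linarith
  · have hv1 : 0 < v := by
      refine hv0.lt_of_ne fun h0 => hp1.ne' ?_
      have : area Ω A = 0 := (measureReal_eq_zero_iff).1 h0.symm
      rw [hp, Measure.real, hac this, ENNReal.toReal_zero]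
    have h2 := key (p / v) (by positivity)
    rw [div_mul_cancel₀ _ hv1.ne'] at h2
    linarith

/-! ### Configurations with prescribed local densities -/

theorem exists_finite_partition (α : Type*) [PseudoMetricSpace α] [CompactSpace α]
    [MeasurableSpace α] [OpensMeasurableSpace α] {ε : ℝ} (hε : 0 < ε) :
    ∃ (n : ℕ) (A : ℕ → Set α), (∀ i, MeasurableSet (A i)) ∧ Pairwise (Function.onFun Disjoint A) ∧
      (⋃ i ∈ Finset.range n, A i) = Set.univ ∧ ∀ i, ∀ x ∈ A i, ∀ y ∈ A i, dist x y ≤ ε := by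
  classical
  obtain ⟨t, -, ht, hcov⟩ := finite_cover_balls_of_compact (isCompact_univ (X := α))
    (half_pos hε)
  set t' := ht.toFinset
  set B : ℕ → Set α := fun i => if h : i < t'.card then
    Metric.ball (t'.equivFin.symm ⟨i, h⟩ : α) (ε / 2) else ∅ with hB
  have hBm : ∀ i, MeasurableSet (B i) := fun i => by
    simp only [hB]; split_ifs
    · exact measurableSet_ball
    · exact MeasurableSet.empty
  have hBcov : ∀ x, ∃ i < t'.card, x ∈ B i := by
    intro x
    obtain ⟨c, hc, hx⟩ := Set.mem_iUnion₂.1 (hcov (Set.mem_univ x))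
    refine ⟨t'.equivFin ⟨c, ht.mem_toFinset.2 hc⟩, Fin.is_lt _, ?_⟩
    simp only [hB, Fin.is_lt, dite_true, Fin.eta, Equiv.symm_apply_apply]
    exact hx
  refine ⟨t'.card, fun i => B i \ ⋃ j ∈ Finset.range i, B j, fun i => (hBm i).diff
    (Finset.measurableSet_biUnion _ fun j _ => hBm j), ?_, ?_, ?_⟩
  · intro i j hij
    wlog hlt : i < j generalizing i j
    · exact (this hij.symm (by omega)).symm
    · refine Set.disjoint_left.2 fun x hi hj => hj.2 ?_
      exact Set.mem_biUnion (Finset.mem_coe.2 (Finset.mem_range.2 hlt)) hi.1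
  · refine Set.eq_univ_of_forall fun x => ?_
    have hex : ∃ i, x ∈ B i := (hBcov x).imp fun i h => h.2
    obtain ⟨i, hi, hxi⟩ := hBcov x
    refine Set.mem_biUnion (x := Nat.find hex)
      (Finset.mem_coe.2 (Finset.mem_range.2 ((Nat.find_min' hex hxi).trans_lt hi)))
      ⟨Nat.find_spec hex, fun hmem => ?_⟩
    obtain ⟨j, hj, hxj⟩ := Set.mem_iUnion₂.1 hmem
    exact Nat.find_min hex (Finset.mem_range.1 hj) hxj
  · intro i x hx y hy
    have hx1 := hx.1
    have hy1 := hy.1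
    simp only [hB] at hx1 hy1
    split_ifs at hx1 hy1
    · have := dist_triangle_right x y (t'.equivFin.symm ⟨i, ‹_›⟩ : α)
      rw [Metric.mem_ball] at hx1 hy1
      linarith
    · exact absurd hx1 (Set.notMem_empty x)

theorem exists_separated_finset_subtype (hΩ : IsCompact Ω) {K : Set Ω} (hK : MeasurableSet K)
    {d : ℝ} (hd : 0 < d) :
    ∃ s : Finset Ω, ↑s ⊆ K ∧ (area Ω).real K ≤ s.card * (√3 / 2 * d ^ 2) ∧
      ∀ x ∈ s, ∀ y ∈ s, x ≠ y → d ≤ dist x y := by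
  classical
  have hm : MeasurableSet (Subtype.val '' K) :=
    (MeasurableEmbedding.subtype_coe hΩ.measurableSet).measurableSet_image' hK
  have hsub : Subtype.val '' K ⊆ Ω := by rintro _ ⟨x, -, rfl⟩; exact x.2
  obtain ⟨s, hs, hcard, hsep⟩ := exists_separated_finset hm
    (measure_ne_top_of_subset hsub hΩ.measure_lt_top.ne) hd
  refine ⟨s.subtype (· ∈ Ω), ?_, ?_, ?_⟩
  · intro x hx
    obtain ⟨y, hy, hyx⟩ := hs (Finset.mem_subtype.1 (Finset.mem_coe.1 hx))
    rwa [← Subtype.ext hyx]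
  · rw [Finset.card_subtype, Finset.filter_true_of_mem fun x hx => hsub (hs hx), Measure.real,
      area_apply hΩ]
    exact hcard
  · intro x hx y hy hxy
    exact hsep x (Finset.mem_subtype.1 hx) y (Finset.mem_subtype.1 hy)
      fun h => hxy (Subtype.ext h)

theorem eventually_separation_le {α ι : Type*} [PseudoMetricSpace α] (I : Finset ι)
    (K : ι → Set α) (hK : ∀ i ∈ I, IsCompact (K i)) (hKc : ∀ i ∈ I, IsClosed (K i))
    (hd : (I : Set ι).PairwiseDisjoint K) :
    ∀ᶠ δ : ℝ in 𝓝[>] 0, ∀ i ∈ I, ∀ j ∈ I, i ≠ j → ∀ x ∈ K i, ∀ y ∈ K j, δ ≤ dist x y := by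
  refine (eventually_all_finset I).2 fun i hi => (eventually_all_finset I).2 fun j hj => ?_
  by_cases hij : i = j
  · exact Eventually.of_forall fun _ h => absurd hij h
  · obtain ⟨r, hr, hlt⟩ := Metric.exists_pos_forall_lt_edist (hK i hi) (hKc j hj) (hd hi hj hij)
    have : ∀ᶠ δ : ℝ in 𝓝[>] 0, δ < r :=
      (eventually_lt_nhds (show (0 : ℝ) < r from hr)).filter_mono nhdsWithin_le_nhds
    filter_upwards [this] with δ hδ _ x hx y hy
    have h1 := hlt x hx y hy
    rw [edist_nndist, ENNReal.coe_lt_coe] at h1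
    have h2 : (r : ℝ) < dist x y := by rw [dist_nndist]; exact_mod_cast h1
    linarith

-- Each `K i` receives `⌈N w i⌉` points of a triangular lattice, and surplus points are dropped,
-- which never decreases a minimal distance. The spacings tend to `0`, so for large `N` points of
-- different pieces are farther apart than the lattice spacing.
open Classical in
theorem eventually_exists_configuration (hΩ : IsCompact Ω) (I : Finset ℕ) (K : ℕ → Set Ω)
    (hK : ∀ i ∈ I, IsCompact (K i)) (hd : (I : Set ℕ).PairwiseDisjoint K)
    (hv : ∀ i ∈ I, 0 < (area Ω).real (K i)) (w : ℕ → ℝ) (hw : ∀ i ∈ I, 0 < w i)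
    (hw1 : ∑ i ∈ I, w i = 1) :
    ∀ᶠ N : ℕ in atTop, ∃ X : Configuration Ω, numPoints X = N ∧
      (∀ x ∈ X.1, ∃ i ∈ I, x ∈ K i) ∧
      (∀ i ∈ I, ((X.1.filter (· ∈ K i)).card : ℝ) ≤ N * w i + 1) ∧
      ∀ i ∈ I, ∀ x ∈ X.1, x ∈ K i → -2 * Real.log (halfMinDist X x) -
        Real.log (2 * √3 * (N : ℝ)) ≤ Real.log (w i / (area Ω).real (K i)) := by
  set v : ℕ → ℝ := fun i => (area Ω).real (K i) with hvdef
  obtain ⟨δ, hsep, hδ⟩ := ((eventually_separation_le I K hK (fun i hi => (hK i hi).isClosed)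
    hd).and self_mem_nhdsWithin).exists
  have hδ0 : (0 : ℝ) < δ := hδ
  have hsmall : ∀ᶠ N : ℕ in atTop, ∀ i ∈ I, 2 * v i / (√3 * (N * w i)) < δ ^ 2 := by
    refine (eventually_all_finset I).2 fun i hi => ?_
    have h1 : Tendsto (fun N : ℕ => 2 * v i / (√3 * w i) * ((N : ℝ))⁻¹) atTop
        (𝓝 (2 * v i / (√3 * w i) * 0)) :=
      tendsto_inv_atTop_nhds_zero_nat.const_mul _
    rw [mul_zero] at h1
    filter_upwards [h1.eventually_lt_const (show 0 < δ ^ 2 by positivity)] with N hN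
    refine lt_of_eq_of_lt ?_ hN
    rw [← div_eq_mul_inv, div_div]
    congr 1; ring
  filter_upwards [hsmall, eventually_ge_atTop 2] with N hN hN2
  have hN0 : (0 : ℝ) < N := by exact_mod_cast (by omega : 0 < N)
  -- The spacing for which `K i` has area `N w i` times the lattice cell area `√3 / 2 * d²`. Then `2
  -- √3 N (d / 2)²` equals `v i / w i`.
  set d : ℕ → ℝ := fun i => √(2 * v i / (√3 * (N * w i))) with hd'
  have hdsq : ∀ i ∈ I, d i ^ 2 = 2 * v i / (√3 * (N * w i)) := fun i hi => by
    have := hv i hi; have := hw i hi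
    exact Real.sq_sqrt (by positivity)
  have hd0 : ∀ i ∈ I, 0 < d i := fun i hi => by
    have := hv i hi; have := hw i hi
    exact Real.sqrt_pos.2 (by positivity)
  have hdδ : ∀ i ∈ I, d i ≤ δ := fun i hi =>
    Real.sqrt_le_iff.2 ⟨hδ0.le, (hN i hi).le⟩
  have hS : ∀ i ∈ I, ∃ S : Finset Ω, ↑S ⊆ K i ∧ S.card = ⌈N * w i⌉₊ ∧
      ∀ x ∈ S, ∀ y ∈ S, x ≠ y → d i ≤ dist x y := by
    intro i hi
    have hvi := hv i hi
    have hwi := hw i hi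
    obtain ⟨s, hs, hcard, hsp⟩ :=
      exists_separated_finset_subtype hΩ (hK i hi).measurableSet (hd0 i hi)
    have hle : ⌈N * w i⌉₊ ≤ s.card := by
      rw [Nat.ceil_le]
      rw [hdsq i hi] at hcard
      have e : (s.card : ℝ) * (√3 / 2 * (2 * v i / (√3 * (N * w i)))) =
          v i * (s.card / (N * w i)) := by field_simp
      rw [e] at hcard
      have h1 : 1 ≤ (s.card : ℝ) / (N * w i) := by
        by_contra! hlt
        have := mul_lt_mul_of_pos_left hlt hvi
        rw [mul_one] at this
        exact absurd hcard (not_le.2 this)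
      rwa [one_le_div (by positivity)] at h1
    obtain ⟨t, hts, htc⟩ := Finset.exists_subset_card_eq hle
    exact ⟨t, fun x hx => hs (hts hx), htc, fun x hx y hy => hsp x (hts hx) y (hts hy)⟩
  choose! S hSK hScard hSsep using hS
  have hYcard : N ≤ (I.biUnion S).card := by
    rw [Finset.card_biUnion fun i hi j hj hij => Finset.disjoint_left.2 fun x hx hy =>
      Set.disjoint_left.1 (hd hi hj hij) (hSK i hi hx) (hSK j hj hy)]
    have : (N : ℝ) ≤ ∑ i ∈ I, ((S i).card : ℝ) := by
      calc (N : ℝ) = ∑ i ∈ I, N * w i := by rw [← Finset.mul_sum, hw1, mul_one]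
        _ ≤ _ := Finset.sum_le_sum fun i hi => by rw [hScard i hi]; exact Nat.le_ceil _
    exact_mod_cast this
  obtain ⟨X, hXY, hXc⟩ := Finset.exists_subset_card_eq hYcard
  have hXne : X.Nonempty := Finset.card_pos.1 (by omega)
  have hmem : ∀ i ∈ I, ∀ x ∈ X, x ∈ K i → x ∈ S i := by
    intro i hi x hx hxi
    obtain ⟨j, hj, hxj⟩ := Finset.mem_biUnion.1 (hXY hx)
    by_cases hij : i = j
    · exact hij ▸ hxj
    · exact absurd (hSK j hj hxj) (Set.disjoint_left.1 (hd hi hj hij) hxi)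
  refine ⟨⟨X, hXne⟩, hXc, ?_, ?_, ?_⟩
  · intro x hx
    obtain ⟨j, hj, hxj⟩ := Finset.mem_biUnion.1 (hXY hx)
    exact ⟨j, hj, hSK j hj hxj⟩
  · intro i hi
    have h1 : (X.filter (· ∈ K i)).card ≤ (S i).card := by
      refine Finset.card_le_card fun x hx => ?_
      obtain ⟨hx1, hx2⟩ := Finset.mem_filter.1 hx
      exact hmem i hi x hx1 hx2
    have h2 : ((S i).card : ℝ) ≤ N * w i + 1 := by
      rw [hScard i hi]
      exact (Nat.ceil_lt_add_one (mul_nonneg hN0.le (hw i hi).le)).le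
    exact (Nat.cast_le.2 h1).trans h2
  · intro i hi x hx hxi
    have hvi := hv i hi
    have hwi := hw i hi
    have hdi := hd0 i hi
    have hr : d i / 2 ≤ halfMinDist (⟨X, hXne⟩ : Configuration Ω) x := by
      refine le_halfMinDist _ (by rw [numPoints, hXc]; exact hN2) x fun y hy hyx => ?_
      rw [mul_div_cancel₀ _ two_ne_zero]
      obtain ⟨j, hj, hyj⟩ := Finset.mem_biUnion.1 (hXY hy)
      by_cases hij : i = j
      · subst hij
        exact hSsep i hi x (hmem i hi x hx hxi) y hyj hyx.symm
      · exact (hdδ i hi).trans (hsep i hi j hj hij x hxi y (hSK j hj hyj))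
    have h1 := Real.log_le_log (by positivity) hr
    have h2 : -2 * Real.log (d i / 2) - Real.log (2 * √3 * (N : ℝ)) = Real.log (w i / v i) := by
      have h3 : 2 * Real.log (d i / 2) + Real.log (2 * √3 * (N : ℝ)) = Real.log (v i / w i) := by
        have h4 : 2 * Real.log (d i / 2) = Real.log ((d i / 2) ^ 2) := by
          rw [Real.log_pow]; push_cast; ring
        rw [h4, ← Real.log_mul (by positivity) (by positivity), div_pow, hdsq i hi]
        congr 1
        field_simp
      rw [← inv_div (v i) (w i), Real.log_inv, ← h3]; ring
    linarith

/-! ### Weak closeness and discrete entropy from cell counts -/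

/-- With equal totals, the deficit of one count is the total excess of the others, each at most one.
Thus upper bounds on the counts suffice. -/
theorem abs_sub_le_card_of_le_add_one {ι : Type*} (I : Finset ι) (c u : ι → ℝ)
    (hle : ∀ i ∈ I, c i ≤ u i + 1) (hsum : ∑ i ∈ I, c i = ∑ i ∈ I, u i) :
    ∀ i ∈ I, |c i - u i| ≤ I.card := by
  classical
  intro i hi
  have h1 : (1 : ℝ) ≤ I.card := by exact_mod_cast Finset.card_pos.2 ⟨i, hi⟩
  have h2 : ∑ j ∈ I.erase i, (c j - u j) ≤ ∑ j ∈ I.erase i, (1 : ℝ) :=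
    Finset.sum_le_sum fun j hj => by linarith [hle j (Finset.mem_of_mem_erase hj)]
  have h3 := Finset.add_sum_erase I (fun j => c j - u j) hi
  rw [Finset.sum_sub_distrib c u (s := I), hsum, sub_self] at h3
  rw [Finset.sum_const, Finset.card_erase_of_mem hi, nsmul_eq_mul, mul_one,
    Nat.cast_sub (by exact_mod_cast h1)] at h2
  push_cast at h2
  rw [abs_le]
  constructor <;> linarith [hle i hi]

/-- The integrals of `f` against `μ` and `ν` differ by at most `2 ω + M ε`, for every `f` bounded
by `M` that varies by at most `ω` on sets of diameter `ε`. -/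
def IsIntegralClose {α : Type*} [PseudoMetricSpace α] [MeasurableSpace α] (ε : ℝ)
    (μ ν : Measure α) : Prop :=
  ∀ (f : α → ℝ) (M ω : ℝ), Continuous f → (∀ x, |f x| ≤ M) →
    (∀ x y, dist x y ≤ ε → |f x - f y| ≤ ω) → |∫ x, f x ∂μ - ∫ x, f x ∂ν| ≤ 2 * ω + M * ε

theorem abs_sum_sub_card_mul_le {α : Type*} (s : Finset α) (f : α → ℝ) {a ω : ℝ}
    (h : ∀ x ∈ s, |f x - a| ≤ ω) : |∑ x ∈ s, f x - s.card * a| ≤ s.card * ω := by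
  have : ∑ x ∈ s, f x - s.card * a = ∑ x ∈ s, (f x - a) := by
    rw [Finset.sum_sub_distrib, Finset.sum_const, nsmul_eq_mul]
  rw [this]
  refine (Finset.abs_sum_le_sum_abs _ _).trans ((Finset.sum_le_sum h).trans ?_)
  rw [Finset.sum_const, nsmul_eq_mul]

-- On each cell `f` is replaced by its value at one point, at cost `ω` against either measure. The
-- mismatch of masses costs `M * I.card / N` per cell, hence at most `M * ε` in total.
open Classical in
theorem isIntegralClose_empirical {μ : ProbabilityMeasure Ω} {ε : ℝ} (I : Finset ℕ)
    (A : ℕ → Set Ω) (hAm : ∀ i ∈ I, MeasurableSet (A i)) (hAd : (I : Set ℕ).PairwiseDisjoint A)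
    (hAμ : ∑ i ∈ I, (μ : Measure Ω).real (A i) = 1)
    (hAε : ∀ i ∈ I, ∀ x ∈ A i, ∀ y ∈ A i, dist x y ≤ ε) (hAne : ∀ i ∈ I, (A i).Nonempty)
    (X : Configuration Ω) (hX : ∑ i ∈ I, (X.1.filter (· ∈ A i)).card = numPoints X)
    (hc : ∀ i ∈ I, |((X.1.filter (· ∈ A i)).card : ℝ) -
      numPoints X * (μ : Measure Ω).real (A i)| ≤ I.card)
    (hN : (I.card : ℝ) ^ 2 ≤ numPoints X * ε) :
    IsIntegralClose ε (empirical X : Measure Ω) μ := by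
  intro f M ω hf hM hω
  set N : ℝ := (numPoints X : ℝ) with hNdef
  have hN0 : 0 < N := Nat.cast_pos.2 (Finset.card_pos.2 X.2)
  set w : ℕ → ℝ := fun i => (μ : Measure Ω).real (A i) with hw
  set T : ℕ → Finset Ω := fun i => X.1.filter (· ∈ A i) with hT
  have hM0 : 0 ≤ M := (abs_nonneg _).trans (hM X.2.choose)
  have hfi : Integrable f (μ : Measure Ω) := integrable_of_abs_le hf.measurable hM
  have hTd : (I : Set ℕ).PairwiseDisjoint T := fun i hi j hj hij =>
    Finset.disjoint_left.2 fun x hx hy => Set.disjoint_left.1 (hAd hi hj hij)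
      (Finset.mem_filter.1 hx).2 (Finset.mem_filter.1 hy).2
  have hXT : I.biUnion T = X.1 := by
    refine Finset.eq_of_subset_of_card_le
      (Finset.biUnion_subset.2 fun i _ => Finset.filter_subset _ _) ?_
    rw [Finset.card_biUnion hTd, hX, numPoints]
  have hae : ∫ x, f x ∂(μ : Measure Ω) = ∑ i ∈ I, ∫ x in A i, f x ∂(μ : Measure Ω) := by
    rw [← integral_biUnion_finset I hAm hAd fun i _ => hfi.integrableOn]
    have hU : MeasurableSet (⋃ i ∈ I, A i) := Finset.measurableSet_biUnion I hAm
    have h1 : (μ : Measure Ω).real (⋃ i ∈ I, A i) = 1 := by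
      rw [measureReal_biUnion_finset hAd hAm, hAμ]
    have h2 : ∀ᵐ x ∂(μ : Measure Ω), x ∈ ⋃ i ∈ I, A i := by
      rw [Measure.real, ENNReal.toReal_eq_one_iff] at h1
      exact mem_ae_iff.2 ((prob_compl_eq_zero_iff hU).2 h1)
    rw [Measure.restrict_eq_self_of_ae_mem h2]
  rw [integral_empirical, hae, ← hXT, Finset.sum_biUnion hTd, ← hNdef, Finset.mul_sum,
    ← Finset.sum_sub_distrib]
  have hω0 : 0 ≤ ω := by
    obtain ⟨x, -⟩ := X.2
    have hε0 : 0 ≤ ε := by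
      by_contra! hneg
      nlinarith [sq_nonneg (I.card : ℝ)]
    simpa using hω x x (by simpa using hε0)
  have hterm : ∀ i ∈ I, |N⁻¹ * ∑ x ∈ T i, f x - ∫ x in A i, f x ∂(μ : Measure Ω)| ≤
      N⁻¹ * (T i).card * ω + w i * ω + M * (N⁻¹ * I.card) := by
    intro i hi
    obtain ⟨a, ha⟩ := hAne i hi
    have h1 : |N⁻¹ * ∑ x ∈ T i, f x - N⁻¹ * ((T i).card * f a)| ≤ N⁻¹ * (T i).card * ω := by
      rw [← mul_sub, abs_mul, abs_of_pos (inv_pos.2 hN0), mul_assoc]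
      refine mul_le_mul_of_nonneg_left (abs_sum_sub_card_mul_le _ _ fun x hx => ?_)
        (inv_pos.2 hN0).le
      exact hω x a (hAε i hi x (Finset.mem_filter.1 hx).2 a ha)
    have h2 : |w i * f a - ∫ x in A i, f x ∂(μ : Measure Ω)| ≤ w i * ω := by
      have e : w i * f a - ∫ x in A i, f x ∂(μ : Measure Ω) =
          ∫ x in A i, (f a - f x) ∂(μ : Measure Ω) := by
        rw [integral_sub (integrable_const _) hfi.integrableOn]
        simp [hw]
      rw [e, ← Real.norm_eq_abs, mul_comm]
      refine norm_setIntegral_le_of_norm_le_const (measure_lt_top _ _) fun x hx => ?_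
      exact hω a x (hAε i hi a ha x hx)
    have h3 : |N⁻¹ * ((T i).card * f a) - w i * f a| ≤ M * (N⁻¹ * I.card) := by
      have e : N⁻¹ * ((T i).card * f a) - w i * f a = f a * (N⁻¹ * ((T i).card - N * w i)) := by
        field_simp
      rw [e, abs_mul, abs_mul, abs_of_pos (inv_pos.2 hN0)]
      gcongr
      · exact hM a
      · exact hc i hi
    calc _ = |(N⁻¹ * ∑ x ∈ T i, f x - N⁻¹ * ((T i).card * f a)) +
          (N⁻¹ * ((T i).card * f a) - w i * f a) +
          (w i * f a - ∫ x in A i, f x ∂(μ : Measure Ω))| := by congr 1; ring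
      _ ≤ _ := (abs_add_three _ _ _).trans (by linarith)
  refine (Finset.abs_sum_le_sum_abs _ _).trans ((Finset.sum_le_sum hterm).trans ?_)
  rw [Finset.sum_add_distrib, Finset.sum_add_distrib, ← Finset.sum_mul, ← Finset.sum_mul, hAμ,
    ← Finset.mul_sum, ← Nat.cast_sum, hX, ← hNdef, inv_mul_cancel₀ hN0.ne', Finset.sum_const,
    nsmul_eq_mul]
  have : (I.card : ℝ) * (M * (N⁻¹ * I.card)) = M * (N⁻¹ * (I.card : ℝ) ^ 2) := by ring
  rw [this]
  have h4 : N⁻¹ * (I.card : ℝ) ^ 2 ≤ ε := by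
    rw [inv_mul_le_iff₀ hN0]; exact hN
  have := mul_le_mul_of_nonneg_left h4 hM0
  linarith

open Classical in
theorem discreteEntropy_le_sum (X : Configuration Ω) (I : Finset ℕ) (K : ℕ → Set Ω)
    (hd : (I : Set ℕ).PairwiseDisjoint K) (hX : ∀ x ∈ X.1, ∃ i ∈ I, x ∈ K i) (l : ℕ → ℝ)
    (hl : ∀ i ∈ I, ∀ x ∈ X.1, x ∈ K i →
      -2 * Real.log (halfMinDist X x) - Real.log (2 * √3 * (numPoints X : ℝ)) ≤ l i) :
    ∑ i ∈ I, (X.1.filter (· ∈ K i)).card = numPoints X ∧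
      discreteEntropy X ≤
        (numPoints X : ℝ)⁻¹ * ∑ i ∈ I, ((X.1.filter (· ∈ K i)).card : ℝ) * l i := by
  have hTd : (I : Set ℕ).PairwiseDisjoint fun i => X.1.filter (· ∈ K i) :=
    fun i hi j hj hij => Finset.disjoint_left.2 fun x hx hy =>
      Set.disjoint_left.1 (hd hi hj hij) (Finset.mem_filter.1 hx).2 (Finset.mem_filter.1 hy).2
  have hXT : (I.biUnion fun i => X.1.filter (· ∈ K i)) = X.1 := by
    ext x
    simp only [Finset.mem_biUnion, Finset.mem_filter]
    constructor
    · rintro ⟨i, -, hx, -⟩; exact hx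
    · intro hx
      obtain ⟨i, hi, hxi⟩ := hX x hx
      exact ⟨i, hi, hx, hxi⟩
  refine ⟨by rw [← Finset.card_biUnion hTd, hXT, numPoints], ?_⟩
  rw [discreteEntropy_eq_sum]
  refine mul_le_mul_of_nonneg_left ?_ (by positivity)
  calc _ = ∑ i ∈ I, ∑ x ∈ X.1.filter (· ∈ K i),
        (-2 * Real.log (halfMinDist X x) - Real.log (2 * √3 * (numPoints X : ℝ))) := by
        rw [← Finset.sum_biUnion hTd, hXT]
    _ ≤ _ := by
        refine Finset.sum_le_sum fun i hi => ?_
        rw [← nsmul_eq_mul]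
        refine Finset.sum_le_card_nsmul _ _ _ fun x hx => ?_
        obtain ⟨hx1, hx2⟩ := Finset.mem_filter.1 hx
        exact hl i hi x hx1 hx2

/-! ### The recovery sequence and the conclusion -/

/-- Configurations that approximate a measure of finite entropy both weakly and in entropy. -/
theorem eventually_exists_close (hΩ : IsCompact Ω) {μ : ProbabilityMeasure Ω}
    (h : entropy μ < ⊤) {ε : ℝ} (hε : 0 < ε) :
    ∀ᶠ N : ℕ in atTop, ∃ X : Configuration Ω, numPoints X = N ∧
      discreteEntropy X ≤ ∫ x, density μ x * Real.log (density μ x) ∂(area Ω) + ε ∧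
      IsIntegralClose ε (empirical X : Measure Ω) μ := by
  classical
  have := isFiniteMeasure_area hΩ
  have : CompactSpace Ω := isCompact_iff_compactSpace.1 hΩ
  have hac := absolutelyContinuous_of_entropy_lt_top h
  obtain ⟨hi, -⟩ := integrable_density_mul_log hΩ h
  obtain ⟨n, A, hAm, hAd, hAcov, hAε⟩ := exists_finite_partition Ω hε
  set w : ℕ → ℝ := fun i => (μ : Measure Ω).real (A i) with hw
  set I := (Finset.range n).filter fun i => 0 < w i with hI
  have hIw : ∀ i ∈ I, 0 < w i := fun i hi => (Finset.mem_filter.1 hi).2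
  have hIsum : ∀ g : ℕ → ℝ, ∑ i ∈ I, w i * g i = ∑ i ∈ Finset.range n, w i * g i := by
    intro g
    refine Finset.sum_subset (Finset.filter_subset _ _) fun i hi hiI => ?_
    have : w i = 0 := by
      by_contra hne
      exact hiI (Finset.mem_filter.2 ⟨hi, measureReal_nonneg.lt_of_ne' hne⟩)
    rw [this, zero_mul]
  have hAd' : ∀ s : Set ℕ, s.PairwiseDisjoint A := fun s i _ j _ hij => hAd hij
  have hw1 : ∑ i ∈ I, w i = 1 := by
    have h1 := hIsum fun _ => 1
    simp only [mul_one] at h1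
    rw [h1, hw, ← measureReal_biUnion_finset (hAd' _) fun i _ => hAm i, hAcov]
    simp
  have hv : ∀ i ∈ I, 0 < (area Ω).real (A i) := by
    intro i hi
    refine measureReal_nonneg.lt_of_ne' fun h0 => (hIw i hi).ne' ?_
    have := hac ((measureReal_eq_zero_iff (measure_ne_top _ _)).1 h0)
    simp [hw, Measure.real, this]
  -- The lost factor `exp (-(ε / 2))` of area costs `ε / 2` in the logarithm; the other `ε / 2` is
  -- kept for rounding the counts.
  have hK : ∀ i ∈ I, ∃ K ⊆ A i, IsCompact K ∧
      Real.exp (-(ε / 2)) * (area Ω).real (A i) < (area Ω).real K := by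
    intro i hi
    have hlt : ENNReal.ofReal (Real.exp (-(ε / 2)) * (area Ω).real (A i)) < area Ω (A i) := by
      rw [ENNReal.ofReal_lt_iff_lt_toReal (mul_nonneg (Real.exp_pos _).le measureReal_nonneg)
        (measure_ne_top _ _)]
      refine mul_lt_of_lt_one_left (hv i hi) (Real.exp_lt_one_iff.2 (by linarith))
    obtain ⟨K, hKA, hKc, hKlt⟩ := (hAm i).exists_lt_isCompact_of_ne_top (measure_ne_top _ _) hlt
    refine ⟨K, hKA, hKc, ?_⟩
    rwa [ENNReal.ofReal_lt_iff_lt_toReal (mul_nonneg (Real.exp_pos _).le measureReal_nonneg)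
      (measure_ne_top _ _)] at hKlt
  choose! K hKA hKc hKv using hK
  have hKv0 : ∀ i ∈ I, 0 < (area Ω).real (K i) := fun i hi =>
    (mul_pos (Real.exp_pos _) (hv i hi)).trans (hKv i hi)
  have hKd : (I : Set ℕ).PairwiseDisjoint K := fun i hi j hj hij =>
    (hAd hij).mono (hKA i hi) (hKA j hj)
  set l : ℕ → ℝ := fun i => Real.log (w i / (area Ω).real (K i)) with hl
  have hlim : Tendsto (fun N : ℕ => ((N : ℝ))⁻¹ * ∑ i ∈ I, (I.card : ℝ) * |l i|) atTop (𝓝 0) := by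
    simpa using tendsto_inv_atTop_nhds_zero_nat.mul_const (∑ i ∈ I, (I.card : ℝ) * |l i|)
  have hlim2 : Tendsto (fun N : ℕ => (N : ℝ) * ε) atTop atTop :=
    tendsto_natCast_atTop_atTop.atTop_mul_const hε
  have hent : ∑ i ∈ I, w i * l i ≤
      ∫ x, density μ x * Real.log (density μ x) ∂(area Ω) + ε / 2 := by
    have h1 : ∀ i ∈ I, w i * l i ≤
        w i * Real.log (w i / (area Ω).real (A i)) + w i * (ε / 2) := by
      intro i hi
      rw [← mul_add]
      refine mul_le_mul_of_nonneg_left ?_ (hIw i hi).le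
      have h2 := Real.log_le_log (mul_pos (Real.exp_pos _) (hv i hi)) (hKv i hi).le
      rw [Real.log_mul (Real.exp_pos _).ne' (hv i hi).ne', Real.log_exp] at h2
      rw [hl]; dsimp only
      rw [Real.log_div (hIw i hi).ne' (hKv0 i hi).ne',
        Real.log_div (hIw i hi).ne' (hv i hi).ne']
      linarith
    refine (Finset.sum_le_sum h1).trans ?_
    rw [Finset.sum_add_distrib, ← Finset.sum_mul, hw1, one_mul]
    gcongr
    rw [hIsum fun i => Real.log (w i / (area Ω).real (A i)), ← setIntegral_univ, ← hAcov,
      integral_biUnion_finset _ (fun i _ => hAm i) (hAd' _) fun i _ => hi.integrableOn]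
    exact Finset.sum_le_sum fun i _ => mul_log_le_setIntegral hΩ h (A i)
  filter_upwards [eventually_exists_configuration hΩ I K hKc hKd hKv0 w hIw hw1,
    hlim.eventually_lt_const (half_pos hε), hlim2.eventually_ge_atTop ((I.card : ℝ) ^ 2)]
    with N ⟨X, hXN, hXK, hXc, hXl⟩ hN1 hN2
  have hN0 : (0 : ℝ) < N := by
    rw [← hXN]; exact Nat.cast_pos.2 (Finset.card_pos.2 X.2)
  rw [← hXN] at hXl
  obtain ⟨hsum, hle⟩ := discreteEntropy_le_sum X I K hKd hXK l hXl
  have hcount : ∀ i ∈ I, |((X.1.filter (· ∈ K i)).card : ℝ) - N * w i| ≤ I.card := by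
    refine abs_sub_le_card_of_le_add_one I _ (fun i => N * w i) hXc ?_
    rw [← Nat.cast_sum, hsum, ← Finset.mul_sum, hw1, hXN, mul_one]
  -- Closeness is tested on the cells `A i`, which carry all the mass of `μ`, whereas the points lie
  -- in the smaller sets `K i`; the counts agree.
  have hfilter : ∀ i ∈ I, X.1.filter (· ∈ A i) = X.1.filter (· ∈ K i) := by
    intro i hi
    refine Finset.filter_congr fun x hx => ⟨fun hxA => ?_, fun hxK => hKA i hi hxK⟩
    obtain ⟨j, hj, hxj⟩ := hXK x hx
    by_cases hij : i = j
    · exact hij ▸ hxj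
    · exact absurd (hKA j hj hxj) (Set.disjoint_left.1 (hAd hij) hxA)
  refine ⟨X, hXN, ?_, ?_⟩
  · have h3 : (N : ℝ)⁻¹ * ∑ i ∈ I, ((X.1.filter (· ∈ K i)).card : ℝ) * l i ≤
        ∑ i ∈ I, w i * l i + (N : ℝ)⁻¹ * ∑ i ∈ I, (I.card : ℝ) * |l i| := by
      rw [Finset.mul_sum, Finset.mul_sum, ← Finset.sum_add_distrib]
      refine Finset.sum_le_sum fun i hi => ?_
      have h4 : (((X.1.filter (· ∈ K i)).card : ℝ) - N * w i) * l i ≤ I.card * |l i| :=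
        (le_abs_self _).trans (by
          rw [abs_mul]; exact mul_le_mul_of_nonneg_right (hcount i hi) (abs_nonneg _))
      have h5 := mul_le_mul_of_nonneg_left h4 (inv_pos.2 hN0).le
      have h6 : (N : ℝ)⁻¹ * ((((X.1.filter (· ∈ K i)).card : ℝ) - N * w i) * l i) =
          (N : ℝ)⁻¹ * (((X.1.filter (· ∈ K i)).card : ℝ) * l i) - w i * l i := by
        field_simp
      linarith
    rw [hXN] at hle
    linarith
  · refine isIntegralClose_empirical I A (fun i _ => hAm i) (hAd' _) hw1 (fun i _ => hAε i)
      (fun i hi => ?_) X ?_ (fun i hi => ?_) (by rw [hXN]; exact hN2)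
    · by_contra hne
      have := hIw i hi
      rw [Set.not_nonempty_iff_eq_empty] at hne
      simp [hw, hne] at this
    · rw [← hsum]
      exact Finset.sum_congr rfl fun i hi => by rw [hfilter i hi]
    · rw [hfilter i hi, hXN]; exact hcount i hi

/-- Fills the finitely many `N` not reached by the construction, by thinning out a larger
configuration. -/
theorem exists_configuration_of_entropy_lt_top (hΩ : IsCompact Ω) {μ : ProbabilityMeasure Ω}
    (h : entropy μ < ⊤) (N : ℕ+) : ∃ X : Configuration Ω, numPoints X = N := by
  obtain ⟨n, hn, X, hX, -⟩ := ((eventually_ge_atTop (N : ℕ)).and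
    (eventually_exists_close hΩ h one_pos)).exists
  obtain ⟨Y, -, hY⟩ := Finset.exists_subset_card_eq (s := X.1) (n := N)
    (by rw [← hX] at hn; exact hn)
  exact ⟨⟨Y, Finset.card_pos.1 (hY ▸ N.pos)⟩, hY⟩

theorem exists_diagonal_sequence {P : ℕ → ℕ → Prop} (h : ∀ m, ∀ᶠ N in atTop, P m N) :
    ∃ φ : ℕ → ℕ, Tendsto φ atTop atTop ∧ ∀ᶠ N in atTop, P (φ N) N := by
  classical
  have key : ∀ m, ∀ᶠ N in atTop, m ≤ Nat.findGreatest (fun k => P k N) N ∧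
      P (Nat.findGreatest (fun k => P k N) N) N := by
    intro m
    filter_upwards [h m, eventually_ge_atTop m] with N hP hN
    exact ⟨Nat.le_findGreatest hN hP, Nat.findGreatest_spec (P := fun k => P k N) hN hP⟩
  -- The best quality `k ≤ N` available at `N`. The default value `0` of `Nat.findGreatest` is
  -- harmless, since `P 0 N` holds eventually.
  exact ⟨fun N => Nat.findGreatest (fun k => P k N) N,
    tendsto_atTop.2 fun m => (key m).mono fun N hN => hN.1, (key 0).mono fun N hN => hN.2⟩

theorem tendsto_of_isIntegralClose {α ι : Type*} [PseudoMetricSpace α] [CompactSpace α]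
    [MeasurableSpace α] [OpensMeasurableSpace α] {l : Filter ι} (ν : ι → ProbabilityMeasure α)
    (μ : ProbabilityMeasure α) (ε : ι → ℝ) (hε : Tendsto ε l (𝓝 0))
    (h : ∀ᶠ i in l, IsIntegralClose (ε i) (ν i : Measure α) (μ : Measure α)) :
    Tendsto ν l (𝓝 μ) := by
  refine ProbabilityMeasure.tendsto_iff_forall_integral_tendsto.2 fun f => ?_
  refine Metric.tendsto_nhds.2 fun τ hτ => ?_
  obtain ⟨δ, hδ, hf⟩ := Metric.uniformContinuous_iff.1
    (CompactSpace.uniformContinuous_of_continuous f.continuous) (τ / 4) (by positivity)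
  have h1 : Tendsto (fun i => ‖f‖ * ε i) l (𝓝 0) := by simpa using hε.const_mul ‖f‖
  filter_upwards [h, hε.eventually_lt_const hδ,
    h1.eventually_lt_const (show 0 < τ / 2 by positivity)] with i hi hεi hτi
  rw [Real.dist_eq]
  have := hi f ‖f‖ (τ / 4) f.continuous f.norm_coe_le_norm fun x y hxy =>
    (hf (hxy.trans_lt hεi)).le
  linarith

theorem exists_recovery_sequence (hΩ : IsCompact Ω) {μ : ProbabilityMeasure Ω}
    (h : entropy μ < ⊤) :
    ∃ X : ℕ+ → Configuration Ω, (∀ N : ℕ+, numPoints (X N) = N) ∧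
      Tendsto (fun N => empirical (X N)) atTop (𝓝 μ) ∧
      Tendsto (fun N => ((discreteEntropy (X N) : ℝ) : EReal)) atTop (𝓝 (entropy μ)) := by
  classical
  have : CompactSpace Ω := isCompact_iff_compactSpace.1 hΩ
  obtain ⟨-, he⟩ := integrable_density_mul_log hΩ h
  set e := ∫ x, density μ x * Real.log (density μ x) ∂(area Ω) with hedef
  set P : ℕ → ℕ → Configuration Ω → Prop := fun m N X => numPoints X = N ∧
    discreteEntropy X ≤ e + 1 / ((m : ℝ) + 1) ∧
      IsIntegralClose (1 / ((m : ℝ) + 1)) (empirical X : Measure Ω) μ with hP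
  obtain ⟨φ, hφ, hφP⟩ := exists_diagonal_sequence (P := fun m N => ∃ X, P m N X)
    fun m => eventually_exists_close hΩ h (Nat.one_div_pos_of_nat (n := m))
  have hX : ∀ N : ℕ+, ∃ X : Configuration Ω, numPoints X = N ∧
      ((∃ Y, P (φ N) N Y) → P (φ N) N X) := by
    intro N
    by_cases hex : ∃ Y, P (φ N) N Y
    · obtain ⟨Y, hY⟩ := hex
      exact ⟨Y, hY.1, fun _ => hY⟩
    · obtain ⟨X, hX⟩ := exists_configuration_of_entropy_lt_top hΩ h N
      exact ⟨X, hX, fun h => absurd h hex⟩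
  choose X hXN hXP using hX
  have hcoe : Tendsto (fun N : ℕ+ => (N : ℕ)) atTop atTop := tendsto_PNat_val_atTop_atTop
  have hev : ∀ᶠ N : ℕ+ in atTop, P (φ N) N (X N) :=
    (hcoe.eventually hφP).mono fun N hN => hXP N hN
  have hlim : Tendsto (fun N : ℕ+ => 1 / ((φ N : ℝ) + 1)) atTop (𝓝 0) :=
    tendsto_one_div_add_atTop_nhds_zero_nat.comp (hφ.comp hcoe)
  have hweak : Tendsto (fun N => empirical (X N)) atTop (𝓝 μ) :=
    tendsto_of_isIntegralClose _ _ _ hlim (hev.mono fun N hN => hN.2.2)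
  refine ⟨X, hXN, hweak, ?_⟩
  rw [he]
  -- Below `e` the general lower bound applies, because the sequence already converges weakly; above
  -- `e` the construction does.
  refine (continuous_coe_real_ereal.tendsto e).comp (tendsto_order.2 ⟨fun a ha => ?_, fun a ha => ?_⟩)
  · have h1 : (((a + e) / 2 : ℝ) : EReal) < entropy μ := by
      rw [he, EReal.coe_lt_coe_iff]; linarith
    have h2 : Tendsto (fun N => numPoints (X N)) atTop atTop := by simpa only [hXN] using hcoe
    filter_upwards [eventually_discreteEntropy_ge hΩ X μ h2 hweak h1] with N hN
    linarith
  · filter_upwards [hev, hlim.eventually_lt_const (sub_pos.2 ha)] with N hN hN2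
    linarith [hN.2.1]

theorem entropy_le_liminf (hΩ : IsCompact Ω) (X : ℕ+ → Configuration Ω)
    (μ : ProbabilityMeasure Ω) (hXN : ∀ N : ℕ+, numPoints (X N) = N)
    (hX : Tendsto (fun N => empirical (X N)) atTop (𝓝 μ)) :
    entropy μ ≤ liminf (fun N => ((discreteEntropy (X N) : ℝ) : EReal)) atTop := by
  have hN : Tendsto (fun N => numPoints (X N)) atTop atTop := by
    simpa only [hXN] using tendsto_PNat_val_atTop_atTop
  refine EReal.ge_of_forall_gt_iff_ge.1 fun a ha => ?_
  refine le_liminf_of_le (by isBoundedDefault) ?_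
  filter_upwards [eventually_discreteEntropy_ge hΩ X μ hN hX ha] with N hN
  exact_mod_cast hN

end EntropyApprox

theorem theorem2 (Ω : Set EntropyApprox.Plane) (hΩ : IsCompact Ω) :
    EntropyApprox.IsGammaApproximation
      (fun X : EntropyApprox.Configuration Ω =>
        ((EntropyApprox.discreteEntropy X : ℝ) : EReal)) where
  ne_bot _ := EReal.coe_ne_bot _
  liminf_ge X μ := EntropyApprox.entropy_le_liminf hΩ X μ
  exists_recovery _ h := EntropyApprox.exists_recovery_sequence hΩ h
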